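/- Let $\mathbb D=\{z\in\mathbb C:|z|<1\}$ and let $dA=\frac{dx\,dy}{\pi}$ be the normalized area measure on $\mathbb D$. Let $\mathcal L$ be the class of measurable functions $\Psi:[0,\infty)\to(0,\infty)$ such that (a) $\Psi$ is essentially monotonic, that is, there is a constant $C>0$ such that either $\Psi(x)\le C\Psi(y)$ for all $0\le x\le y$, or $\Psi(y)\le C\Psi(x)$ for all $0\le x\le y$; (b) there is a constant $C>0$ such that $C^{-1}\Psi(x)\le\Psi(x^2)\le C\Psi(x)$ for all $0\le x<\infty$. A radial weight is an integrable function $\omega:\mathbb D\to[0,\infty)$ such that $\omega(z)=\omega(|z|)$ for all $z\in\mathbb D$ and $\widehat\omega(r)=\int_r^1\omega(s)\,ds>0$ for all $0\le r<1$. Let $\mathcal D$ be the class of radial weights $\omega$ for which there exist constants $C\ge1$, $K>1$ and $C'>1$ such that $$\widehat\omega(r)\le C\,\widehat\omega\Big(\frac{1+r}2\Big)\quad\text{and}\quad \widehat\omega(r)\ge C'\,\widehat\omega\Big(1-\frac{1-r}K\Big)\qquad\text{for all }0\le r<1.$$ For $0<p<\infty$, the weighted Bergman--Zygmund space $A^p_{\omega,\Psi}$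 consists of all analytic functions $f$ in $\mathbb D$ such that $$\|f\|_{A^p_{\omega,\Psi}}=\Big(\int_{\mathbb D}|f(z)|^p\,\Psi(|f(z)|)\,\omega(z)\,dA(z)\Big)^{1/p}<\infty,$$ and the weighted Bergman space $A^p_\omega$, with $\|\cdot\|_{A^p_\omega}$, is the case $\Psi\equiv1$. A set of functions in such a space is bounded if $\|\cdot\|$ is bounded on it by a finite constant, and a mapping between two such spaces is bounded if it maps bounded sets to bounded sets. **Proposition.** Let $0<p<\infty$, $\Psi\in\mathcal L$ and $\omega\in\mathcal D$, and set $W(z)=\Psi\big(\frac1{1-|z|}\big)\,\omega(z)$ for $z\in\mathbb D$. Then: (i) $W\in\mathcal D$; (ii) $A^p_{\omega,\Psi}=A^p_W$ as sets; (iii) the identity mappings $I:A^p_{\omega,\Psi}\to A^p_W$ and $I:A^p_W\to A^p_{\omega,\Psi}$ are bounded; (iv) for every sequence $(f_n)$ in $A^p_{\omega,\Psi}=A^p_W$, one has $\lim_{n\to\infty}\|f_n\|_{A^p_W}=0$ if and only if $\lim_{n\to\infty}\|f_n\|_{A^p_{\omega,\Psi}}=0$. -/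

import Mathlib

open MeasureTheory Filter Topology
open scoped ENNReal

noncomputable section

namespace BergmanZygmund

/-- The open unit disc of the complex plane. -/
def disc : Set ℂ := Metric.ball (0 : ℂ) 1

/-- The normalized area measure `dA = dx dy / π` on the unit disc. -/
def areaMeasure : Measure ℂ :=
  (ENNReal.ofReal Real.pi)⁻¹ • (volume : Measure ℂ).restrict disc

/-- `Ψ` is essentially increasing on `[0, ∞)`. -/
def EssIncreasing (Ψ : ℝ → ℝ) : Prop :=
  ∃ C : ℝ, 0 < C ∧ ∀ x y : ℝ, 0 ≤ x → x ≤ y → Ψ x ≤ C * Ψ y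

/-- `Ψ` is essentially decreasing on `[0, ∞)`. -/
def EssDecreasing (Ψ : ℝ → ℝ) : Prop :=
  ∃ C : ℝ, 0 < C ∧ ∀ x y : ℝ, 0 ≤ x → x ≤ y → Ψ y ≤ C * Ψ x

/-- The class `𝓛` of measurable, essentially monotonic functions `Ψ : [0, ∞) → (0, ∞)` such that
`Ψ x ≍ Ψ (x ^ 2)` for `0 ≤ x < ∞`. Only the values of `Ψ` on `[0, ∞)` matter. -/
structure ClassL (Ψ : ℝ → ℝ) : Prop where
  pos : ∀ x : ℝ, 0 ≤ x → 0 < Ψ x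
  measurable : Measurable (fun x : Set.Ici (0 : ℝ) => Ψ x)
  essMonotonic : EssIncreasing Ψ ∨ EssDecreasing Ψ
  doubling : ∃ C : ℝ, 0 < C ∧
    ∀ x : ℝ, 0 ≤ x → Ψ x ≤ C * Ψ (x ^ 2) ∧ Ψ (x ^ 2) ≤ C * Ψ x

/-- The tail integral `∫_r^1 ω(s) ds` of a radial weight (possibly infinite, a priori, at
`r = 0`). -/
def tail (ω : ℂ → ℝ) (r : ℝ) : ℝ≥0∞ :=
  ∫⁻ s in Set.Ico r 1, ENNReal.ofReal (ω (s : ℂ))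

/-- Radial weights on the unit disc: nonnegative integrable radial functions with strictly positive
tail integrals. Only the values of `ω` on the disc matter. -/
structure IsRadialWeight (ω : ℂ → ℝ) : Prop where
  nonneg : ∀ z ∈ disc, 0 ≤ ω z
  integrable : Integrable ω areaMeasure
  radial : ∀ z ∈ disc, ω z = ω ((‖z‖ : ℝ) : ℂ)
  tail_pos : ∀ r : ℝ, 0 ≤ r → r < 1 → 0 < tail ω r

/-- The upper doubling condition for radial weights. -/
def ClassDHat (ω : ℂ → ℝ) : Prop :=
  IsRadialWeight ω ∧ ∃ C : ℝ, 1 ≤ C ∧ ∀ r : ℝ, 0 ≤ r → r < 1 →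
    tail ω r ≤ ENNReal.ofReal C * tail ω ((1 + r) / 2)

/-- The lower (reverse) doubling condition for radial weights. -/
def ClassDCheck (ω : ℂ → ℝ) : Prop :=
  IsRadialWeight ω ∧ ∃ K C : ℝ, 1 < K ∧ 1 < C ∧ ∀ r : ℝ, 0 ≤ r → r < 1 →
    ENNReal.ofReal C * tail ω (1 - (1 - r) / K) ≤ tail ω r

/-- The class `𝓓` of two-sided doubling radial weights. -/
def ClassD (ω : ℂ → ℝ) : Prop := ClassDHat ω ∧ ClassDCheck ω

/-- The Lebesgue--Zygmund quasinorm `(∫ |f|^p Ψ(|f|) dμ)^(1/p)`, with values in `[0, ∞]`. -/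
def zygmundNorm (p : ℝ) (Ψ : ℝ → ℝ) (μ : Measure ℂ) (f : ℂ → ℂ) : ℝ≥0∞ :=
  (∫⁻ z, ENNReal.ofReal (‖f z‖ ^ p * Ψ ‖f z‖) ∂μ) ^ (1 / p)

/-- The Lebesgue--Zygmund space `L^p_{μ,Ψ}`. -/
def lebesgueZygmund (p : ℝ) (Ψ : ℝ → ℝ) (μ : Measure ℂ) : Set (ℂ → ℂ) :=
  {f | AEStronglyMeasurable f μ ∧ zygmundNorm p Ψ μ f < ∞}

/-- The measure `ω dA` on the unit disc. -/
def weightMeasure (ω : ℂ → ℝ) : Measure ℂ :=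
  areaMeasure.withDensity (fun z => ENNReal.ofReal (ω z))

/-- The quasinorm of the Bergman--Zygmund space `A^p_{ω,Ψ}`. -/
def bergmanZygmundNorm (p : ℝ) (ω : ℂ → ℝ) (Ψ : ℝ → ℝ) (f : ℂ → ℂ) : ℝ≥0∞ :=
  zygmundNorm p Ψ (weightMeasure ω) f

/-- The weighted Bergman--Zygmund space `A^p_{ω,Ψ}`: the functions in `L^p_{ω,Ψ}` that are analytic
in the unit disc. (Values outside the disc are irrelevant.) -/
def bergmanZygmund (p : ℝ) (ω : ℂ → ℝ) (Ψ : ℝ → ℝ) : Set (ℂ → ℂ) :=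
  lebesgueZygmund p Ψ (weightMeasure ω) ∩ {f | AnalyticOnNhd ℂ f disc}

/-- The (quasi)norm of the weighted Bergman space `A^p_ω`: the case `Ψ = 1`. -/
def bergmanNorm (p : ℝ) (ω : ℂ → ℝ) (f : ℂ → ℂ) : ℝ≥0∞ :=
  bergmanZygmundNorm p ω (fun _ => 1) f

/-- The weighted Bergman space `A^p_ω`: the case `Ψ = 1`. -/
def bergman (p : ℝ) (ω : ℂ → ℝ) : Set (ℂ → ℂ) :=
  bergmanZygmund p ω (fun _ => 1)

/-- A set of functions is bounded with respect to a (quasi)norm `N`. -/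
def IsBddSet (N : (ℂ → ℂ) → ℝ≥0∞) (S : Set (ℂ → ℂ)) : Prop :=
  ∃ M : ℝ, ∀ f ∈ S, N f ≤ ENNReal.ofReal M

/-- The operator `T` is a bounded operator from `X` with quasinorm `N` to `Y` with quasinorm `N'`:
it maps `X` into `Y`, and bounded subsets of `X` to bounded subsets of `Y`. -/
def IsBddOperator (X : Set (ℂ → ℂ)) (N : (ℂ → ℂ) → ℝ≥0∞) (Y : Set (ℂ → ℂ))
    (N' : (ℂ → ℂ) → ℝ≥0∞) (T : (ℂ → ℂ) → (ℂ → ℂ)) : Prop :=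
  Set.MapsTo T X Y ∧ ∀ S : Set (ℂ → ℂ), S ⊆ X → IsBddSet N S → IsBddSet N' (T '' S)

/-- The auxiliary weight `W(z) = Ψ(1 / (1 - |z|)) ω(z)`. -/
def auxWeight (ω : ℂ → ℝ) (Ψ : ℝ → ℝ) (z : ℂ) : ℝ := Ψ (1 / (1 - ‖z‖)) * ω z

end BergmanZygmund

end

open BergmanZygmund

/-! Write R = 1/(1-|z|). Functions in the class are insensitive to replacing their argument by a
power of it, so Ψ(|f(z)|) and Ψ(R) are comparable wherever |f(z)| and R are bounded by powers of
each other.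

One half of this is a growth bound. Subharmonicity of |f|^q and the polynomial lower bound for the
tail (upper doubling) give |f(z)| ≤ A R^N, with A depending only on a bound for ∫|f|^q ω
(`ClassDHat.exists_growth`). For essentially increasing Ψ this yields Ψ(|f|) ≲ Ψ(R). The other half
may fail, but only where |f| < κ R^δ₁. There the integrand is at most η R^δ, which reverse doubling
makes integrable for small δ, with η as small as desired (`exists_rpow_mul_le_add`). For essentially
decreasing Ψ the two integrands exchange roles.

The quantity with general Ψ is not homogeneous, so no single norm inequality is sought. The relation
`Controls` records separately that bounded sets stay bounded and that small functions stay small;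
`ClassD.controls` establishes it in both directions. That W is doubling follows from the comparison
of its tail with Ψ(1/(1-r)) times the tail of ω (`exists_tail_auxWeight_comparable`). -/

namespace BergmanZygmund

/-! ### Subharmonicity of powers of the modulus -/

open Metric Real in
/-- A function analytic near a closed disc is, up to a zero-free analytic factor, a polynomial given
by its zeros. -/
theorem exists_eq_prod_mul_of_analyticOnNhd {f : ℂ → ℂ} {s : ℝ} (hs : 0 < s)
    (hf : AnalyticOnNhd ℂ f (closedBall 0 s)) {w : ℂ} (hw : w ∈ closedBall (0 : ℂ) s)
    (hfw : f w ≠ 0) :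
    ∃ (S : Finset ℂ) (n : ℂ → ℕ) (g : ℂ → ℂ), (S : Set ℂ) ⊆ closedBall 0 s ∧
      AnalyticOnNhd ℂ g (closedBall 0 s) ∧ (∀ z ∈ closedBall (0 : ℂ) s, g z ≠ 0) ∧
      ∀ z ∈ closedBall (0 : ℂ) s, f z = (∏ a ∈ S, (z - a) ^ n a) * g z := by
  set U := closedBall (0 : ℂ) s
  have hconn : IsConnected U :=
    ⟨nonempty_closedBall.mpr hs.le, (convex_closedBall 0 s).isPreconnected⟩
  have hord : ∀ u : U, meromorphicOrderAt f u ≠ ⊤ := by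
    refine (hf.meromorphicOn.exists_meromorphicOrderAt_ne_top_iff_forall hconn).1 ⟨⟨w, hw⟩, ?_⟩
    have h0 : meromorphicOrderAt f w = 0 := by
      rw [(hf w hw).meromorphicNFAt.meromorphicOrderAt_eq_zero_iff]
      exact hfw
    simp [h0]
  have hfin : (MeromorphicOn.divisor f U).support.Finite :=
    (MeromorphicOn.divisor f U).finiteSupport (isCompact_closedBall 0 s)
  obtain ⟨g, hg, hg0, hfg⟩ := hf.meromorphicOn.extract_zeros_poles hord hfin
  have hD := MeromorphicOn.AnalyticOnNhd.divisor_nonneg hf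
  set D := MeromorphicOn.divisor f U
  refine ⟨hfin.toFinset, fun a => (D a).toNat, g, ?_, hg, fun z hz => hg0 ⟨z, hz⟩, ?_⟩
  · intro a ha
    exact D.supportWithinDomain (by simpa using ha)
  intro z hz
  have hP : (∏ᶠ u, (· - u) ^ D u : ℂ → ℂ) = fun z => ∏ a ∈ hfin.toFinset, (z - a) ^ (D a).toNat := by
    rw [finprod_eq_prod_of_mulSupport_subset (s := hfin.toFinset) _
      (by rw [Function.FactorizedRational.mulSupport]; simp)]
    ext z
    rw [Finset.prod_apply]
    refine Finset.prod_congr rfl fun a _ => ?_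
    simp only [Pi.pow_apply]
    conv_lhs => rw [← Int.toNat_of_nonneg (hD a)]
    exact zpow_natCast _ _
  rw [hP] at hfg
  have hPan : AnalyticAt ℂ (fun z => (∏ a ∈ hfin.toFinset, (z - a) ^ (D a).toNat) * g z) z := by
    refine AnalyticAt.mul ?_ (hg z hz)
    refine Finset.analyticAt_fun_prod _ fun a _ => ?_
    fun_prop
  -- The factorization is so far known only off a discrete set. The closed disc has no isolated
  -- points, so continuity extends it to every point, the bounding circle included.
  have hpp : Preperfect U := by
    refine hconn.isPreconnected.preperfect_of_nontrivial ⟨0, ?_, (s : ℂ), ?_, ?_⟩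
    · simp [U, hs.le]
    · simp [U, abs_of_pos hs]
    · exact_mod_cast hs.ne
  have h1 := (hf z hz).meromorphicAt.eventuallyEq_nhdsNE_of_eventuallyEq_codiscreteWithin_preperfect
    hPan.meromorphicAt hz hpp hfg
  exact (((hf z hz).continuousAt.eventuallyEq_nhds_iff_eventuallyEq_nhdsNE
    hPan.continuousAt).1 h1).eq_of_nhds

/-- The right side vanishes for |z| = s and is nonnegative for |a|, |z| ≤ s. This is what allows a
factor z - a to be replaced by its Blaschke reflection (s² - āz)/s. -/
theorem norm_sq_sub_conj_mul_sub (s : ℝ) (a z : ℂ) :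
    ‖(s : ℂ) ^ 2 - (starRingEnd ℂ) a * z‖ ^ 2 - s ^ 2 * ‖z - a‖ ^ 2 =
      (s ^ 2 - ‖a‖ ^ 2) * (s ^ 2 - ‖z‖ ^ 2) := by
  simp only [← Complex.normSq_eq_norm_sq, Complex.normSq_apply]
  simp [pow_two]
  ring

open Metric in
/-- The zeros inside a disc can be divided out, without changing the modulus on the circle and
without decreasing it in the disc. -/
theorem exists_ne_zero_norm_le {f : ℂ → ℂ} {s : ℝ} (hs : 0 < s)
    (hf : AnalyticOnNhd ℂ f (closedBall 0 s)) {w : ℂ} (hw : w ∈ closedBall (0 : ℂ) s)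
    (hfw : f w ≠ 0) :
    ∃ h : ℂ → ℂ, AnalyticOnNhd ℂ h (closedBall 0 s) ∧ (∀ z ∈ ball (0 : ℂ) s, h z ≠ 0) ∧
      (∀ z ∈ closedBall (0 : ℂ) s, ‖f z‖ ≤ ‖h z‖) ∧ ∀ z ∈ sphere (0 : ℂ) s, ‖f z‖ = ‖h z‖ := by
  classical
  obtain ⟨S, n, g, hS, hg, hg0, hfg⟩ := exists_eq_prod_mul_of_analyticOnNhd hs hf hw hfw
  -- Only zeros in the open disc are reflected. A zero on the circle keeps its factor, which does
  -- not vanish inside.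
  let b : ℂ → ℂ → ℂ := fun a z =>
    if ‖a‖ < s then ((s : ℂ) ^ 2 - (starRingEnd ℂ) a * z) / s else z - a
  have hsq (a z : ℂ) (ha : ‖a‖ < s) : s ^ 2 * ‖b a z‖ ^ 2 =
      s ^ 2 * ‖z - a‖ ^ 2 + (s ^ 2 - ‖a‖ ^ 2) * (s ^ 2 - ‖z‖ ^ 2) := by
    have := norm_sq_sub_conj_mul_sub s a z
    simp only [b, if_pos ha, norm_div, Complex.norm_real, Real.norm_eq_abs, abs_of_pos hs]
    field_simp
    linarith
  have hle (a z : ℂ) (hz : ‖z‖ ≤ s) : ‖z - a‖ ≤ ‖b a z‖ := by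
    by_cases ha : ‖a‖ < s
    · have h1 := hsq a z ha
      have h2 : 0 ≤ (s ^ 2 - ‖a‖ ^ 2) * (s ^ 2 - ‖z‖ ^ 2) := by
        apply mul_nonneg <;> nlinarith [norm_nonneg a, norm_nonneg z]
      have h3 : s ^ 2 * ‖z - a‖ ^ 2 ≤ s ^ 2 * ‖b a z‖ ^ 2 := by linarith
      exact le_of_sq_le_sq (le_of_mul_le_mul_left h3 (by positivity)) (norm_nonneg _)
    · simp [b, if_neg ha]
  have heq (a z : ℂ) (hz : ‖z‖ = s) : ‖z - a‖ = ‖b a z‖ := by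
    by_cases ha : ‖a‖ < s
    · have h1 := hsq a z ha
      rw [hz, sub_self, mul_zero, add_zero] at h1
      exact ((sq_eq_sq₀ (norm_nonneg _) (norm_nonneg _)).1
        (mul_left_cancel₀ (by positivity) h1)).symm
    · simp [b, if_neg ha]
  refine ⟨fun z => (∏ a ∈ S, b a z ^ n a) * g z, fun z hz => ?_, fun z hz => ?_,
    fun z hz => ?_, fun z hz => ?_⟩
  · refine AnalyticAt.mul (Finset.analyticAt_fun_prod _ fun a _ => ?_) (hg z hz)
    by_cases ha : ‖a‖ < s
    · simp only [b, if_pos ha]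
      have : (s : ℂ) ≠ 0 := by exact_mod_cast hs.ne'
      fun_prop (disch := assumption)
    · simp only [b, if_neg ha]
      fun_prop
  · refine mul_ne_zero (Finset.prod_ne_zero_iff.2 fun a _ => pow_ne_zero _ fun h0 => ?_)
      (hg0 z (ball_subset_closedBall hz))
    have hz' : ‖z‖ < s := by simpa using hz
    by_cases ha : ‖a‖ < s
    · have h1 := hsq a z ha
      have h2 : 0 < (s ^ 2 - ‖a‖ ^ 2) * (s ^ 2 - ‖z‖ ^ 2) := by
        apply mul_pos <;> nlinarith [norm_nonneg a, norm_nonneg z]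
      rw [h0] at h1
      simp only [norm_zero] at h1
      nlinarith [mul_nonneg (sq_nonneg s) (sq_nonneg ‖z - a‖)]
    · simp only [b, if_neg ha] at h0
      rw [sub_eq_zero] at h0
      exact ha (h0 ▸ hz')
  · rw [hfg z hz, norm_mul, norm_mul, norm_prod, norm_prod]
    refine mul_le_mul_of_nonneg_right (Finset.prod_le_prod (fun _ _ => norm_nonneg _)
      fun a _ => ?_) (norm_nonneg _)
    rw [norm_pow, norm_pow]
    exact pow_le_pow_left₀ (norm_nonneg _) (hle a z (by simpa using hz)) _
  · rw [hfg z (sphere_subset_closedBall hz), norm_mul, norm_mul, norm_prod, norm_prod]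
    congr 1
    refine Finset.prod_congr rfl fun a _ => ?_
    rw [norm_pow, norm_pow, heq a z (by simpa using hz)]

open Metric in
-- L is the primitive of h'/h with L(0) = log h(0); then h·exp(-L) has zero derivative and equals 1
-- at the origin.
theorem exists_eq_exp_of_ne_zero {h : ℂ → ℂ} {s : ℝ} (hs : 0 < s)
    (hh : DifferentiableOn ℂ h (ball 0 s)) (h0 : ∀ z ∈ ball (0 : ℂ) s, h z ≠ 0) :
    ∃ L : ℂ → ℂ, DifferentiableOn ℂ L (ball 0 s) ∧ ∀ z ∈ ball (0 : ℂ) s, h z = Complex.exp (L z) := by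
  have hd : DifferentiableOn ℂ (fun z => deriv h z / h z) (ball 0 s) :=
    (hh.deriv isOpen_ball).div hh h0
  obtain ⟨L, hL0, hL⟩ := hd.isConservativeOn.isExactOn_ball hd.continuousOn |>.with_val_at 0
    (Complex.log (h 0))
  have hLd : DifferentiableOn ℂ L (ball 0 s) := fun z hz => (hL z hz).differentiableAt.differentiableWithinAt
  refine ⟨L, hLd, fun z hz => ?_⟩
  have hder (z : ℂ) (hz : z ∈ ball (0 : ℂ) s) :
      HasDerivAt (fun z => h z * Complex.exp (-L z)) 0 z := by
    have h1 := (hh.differentiableAt (isOpen_ball.mem_nhds hz)).hasDerivAt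
    refine (h1.mul ((hL z hz).neg.cexp)).congr_deriv ?_
    have := h0 z hz
    field_simp
    ring
  have hc : h z * Complex.exp (-L z) = h 0 * Complex.exp (-L 0) := by
    have h00 : (0 : ℂ) ∈ ball (0 : ℂ) s := mem_ball_self hs
    refine isOpen_ball.is_const_of_deriv_eq_zero (convex_ball 0 s).isPreconnected
      (fun z hz => (hder z hz).differentiableAt.differentiableWithinAt)
      (fun z hz => (hder z hz).deriv) hz h00
  rw [hL0, Complex.exp_neg, Complex.exp_neg, Complex.exp_log (h0 0 (mem_ball_self hs)),
    mul_inv_cancel₀ (h0 0 (mem_ball_self hs))] at hc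
  field_simp at hc
  exact hc

open Metric Real in
-- Cauchy's formula with |z - w| ≥ s - |w|. This constant is cruder than the Poisson kernel, but
-- only polynomial growth is needed later.
theorem norm_le_mul_circleAverage {F : ℂ → ℂ} {s : ℝ} (hF : DiffContOnCl ℂ F (ball 0 s)) {w : ℂ}
    (hw : w ∈ ball (0 : ℂ) s) : ‖F w‖ ≤ s / (s - ‖w‖) * circleAverage (fun z => ‖F z‖) 0 s := by
  have hs : 0 < s := pos_of_mem_ball hw
  have hw' : ‖w‖ < s := by simpa using hw
  rw [← abs_of_pos hs] at hF hw
  have h1 := hF.circleAverage_smul_div hw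
  rw [abs_of_pos hs] at hF
  have hcF : ContinuousOn F (sphere 0 |s|) := by
    rw [abs_of_pos hs]
    exact hF.continuousOn.mono (sphere_subset_closedBall.trans (closure_ball 0 hs.ne').symm.subset)
  have hne (z : ℂ) (hz : z ∈ sphere (0 : ℂ) |s|) : s - ‖w‖ ≤ ‖z - w‖ := by
    have : ‖z‖ = s := by simpa [abs_of_pos hs] using hz
    linarith [norm_sub_norm_le z w]
  have hne0 (z : ℂ) (hz : z ∈ sphere (0 : ℂ) |s|) : z - w ≠ 0 := by
    rw [← norm_pos_iff]; linarith [hne z hz]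
  rw [← h1, ← smul_eq_mul (s / (s - ‖w‖)), ← circleAverage_fun_smul]
  have h2 : ‖circleAverage (fun z => ((z - 0) / (z - w)) • F z) 0 s‖ ≤
      circleAverage (fun z => ‖((z - 0) / (z - w)) • F z‖) 0 s := by
    rw [circleAverage_def, circleAverage_def, norm_smul, Real.norm_of_nonneg (by positivity),
      smul_eq_mul]
    gcongr
    exact intervalIntegral.norm_integral_le_integral_norm two_pi_pos.le
  refine h2.trans (circleAverage_mono (ContinuousOn.circleIntegrable' ?_)
    (ContinuousOn.circleIntegrable' ?_) fun z hz => ?_)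
  · fun_prop (disch := assumption)
  · fun_prop
  · have hz' : ‖z‖ = s := by simpa [abs_of_pos hs] using hz
    rw [norm_smul, norm_div, sub_zero, hz', smul_eq_mul]
    have := hne z hz
    have : 0 < s - ‖w‖ := by linarith
    gcongr

open Metric Real in
/-- A quantitative form of the subharmonicity of `|f| ^ q`, for all `q > 0`. -/
theorem norm_rpow_le_mul_circleAverage {f : ℂ → ℂ} {s q : ℝ} (hq : 0 < q)
    (hf : AnalyticOnNhd ℂ f (closedBall 0 s)) {w : ℂ} (hw : w ∈ ball (0 : ℂ) s) :
    ‖f w‖ ^ q ≤ s / (s - ‖w‖) * circleAverage (fun z => ‖f z‖ ^ q) 0 s := by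
  have hs : 0 < s := pos_of_mem_ball hw
  have hw' : ‖w‖ < s := by simpa using hw
  by_cases hfw : f w = 0
  · rw [hfw, norm_zero, zero_rpow hq.ne']
    exact mul_nonneg (div_nonneg hs.le (by linarith))
      (circleAverage_nonneg_of_nonneg fun z _ => by positivity)
  obtain ⟨h, hh, hh0, hle, heq⟩ := exists_ne_zero_norm_le hs hf (ball_subset_closedBall hw) hfw
  obtain ⟨L, hL, hexp⟩ := exists_eq_exp_of_ne_zero hs
    (hh.differentiableOn.mono ball_subset_closedBall) hh0
  have hnorm (z : ℂ) (hz : z ∈ ball (0 : ℂ) s) : ‖Complex.exp (q * L z)‖ = ‖h z‖ ^ q := by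
    rw [hexp z hz, Complex.norm_exp, Complex.norm_exp, ← Real.exp_mul]
    simp [mul_comm]
  -- The function h may vanish on the circle of radius s, so its logarithm lives only on the open
  -- disc. The estimate is proved on radii t < s and passed to the limit t → s.
  have key (t : ℝ) (ht : t ∈ Set.Ioo ‖w‖ s) :
      ‖h w‖ ^ q ≤ t / (t - ‖w‖) * circleAverage (fun z => ‖h z‖ ^ q) 0 t := by
    have ht0 : 0 < t := (norm_nonneg w).trans_lt ht.1
    have hsub : closedBall (0 : ℂ) t ⊆ ball 0 s := closedBall_subset_ball ht.2
    have hF : DifferentiableOn ℂ (fun z => Complex.exp (q * L z)) (closure (ball 0 t)) := by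
      rw [closure_ball 0 ht0.ne']
      exact ((hL.mono hsub).const_mul _).cexp
    have h1 := norm_le_mul_circleAverage hF.diffContOnCl (w := w) (by simpa using ht.1)
    rw [hnorm w hw] at h1
    rwa [circleAverage_congr_sphere (f₂ := fun z => ‖h z‖ ^ q)] at h1
    intro z hz
    rw [abs_of_pos ht0] at hz
    exact hnorm z (hsub (sphere_subset_closedBall hz))
  have hcont : ContinuousOn (fun t => t / (t - ‖w‖) * circleAverage (fun z => ‖h z‖ ^ q) 0 t)
      (Set.Ioc ‖w‖ s) := by
    refine ContinuousOn.mul (ContinuousOn.div continuousOn_id (by fun_prop) fun t ht => ?_) ?_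
    · exact (sub_pos.2 ht.1).ne'
    · refine ContinuousOn.circleAverage ?_ fun t ht => (norm_nonneg w).trans ht.1.le
      refine ContinuousOn.rpow_const ?_ fun _ _ => Or.inr hq.le
      refine (hh.continuousOn.mono fun z hz => ?_).norm
      simpa using hz.2
  have hlim : ‖h w‖ ^ q ≤ s / (s - ‖w‖) * circleAverage (fun z => ‖h z‖ ^ q) 0 s := by
    have hmem : s ∈ closure (Set.Ioo ‖w‖ s) := by
      rw [closure_Ioo hw'.ne]; exact ⟨hw'.le, le_rfl⟩
    have hne : (𝓝[Set.Ioo ‖w‖ s] s).NeBot := mem_closure_iff_nhdsWithin_neBot.1 hmem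
    have ht := ((hcont s ⟨hw', le_rfl⟩).mono Set.Ioo_subset_Ioc_self).tendsto
    exact ge_of_tendsto ht (eventually_nhdsWithin_of_forall key)
  refine (rpow_le_rpow (norm_nonneg _) (hle w (ball_subset_closedBall hw)) hq.le).trans ?_
  rw [circleAverage_congr_sphere (f₂ := fun z => ‖h z‖ ^ q)]
  · exact hlim
  · intro z hz
    rw [abs_of_pos hs] at hz
    simp only [heq z hz]

/-! ### Slow variation of functions in the class -/

/-- Reciprocals exchange the two kinds of monotonicity, which reduces essentially decreasing
functions to essentially increasing ones. -/
theorem ClassL.inv {Ψ : ℝ → ℝ} (hΨ : ClassL Ψ) : ClassL (fun x => (Ψ x)⁻¹) where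
  pos x hx := inv_pos.2 (hΨ.pos x hx)
  measurable := hΨ.measurable.inv
  essMonotonic := by
    have key {C a b : ℝ} (hC : 0 < C) (ha : 0 < a) (hb : 0 < b) (h : a ≤ C * b) :
        b⁻¹ ≤ C * a⁻¹ := by
      rw [← div_eq_mul_inv, le_div_iff₀ ha, inv_mul_le_iff₀ hb]
      linarith
    rcases hΨ.essMonotonic with ⟨C, hC, h⟩ | ⟨C, hC, h⟩
    · exact Or.inr ⟨C, hC, fun x y hx hxy =>
        key hC (hΨ.pos x hx) (hΨ.pos y (hx.trans hxy)) (h x y hx hxy)⟩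
    · exact Or.inl ⟨C, hC, fun x y hx hxy =>
        key hC (hΨ.pos y (hx.trans hxy)) (hΨ.pos x hx) (h x y hx hxy)⟩
  doubling := by
    have key {C a b : ℝ} (ha : 0 < a) (hb : 0 < b) (h : a ≤ C * b) :
        b⁻¹ ≤ C * a⁻¹ := by
      rw [← div_eq_mul_inv, le_div_iff₀ ha, inv_mul_le_iff₀ hb]
      linarith
    obtain ⟨C, hC, h⟩ := hΨ.doubling
    exact ⟨C, hC, fun x hx =>
      ⟨key (hΨ.pos _ (sq_nonneg x)) (hΨ.pos x hx) (h x hx).2,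
        key (hΨ.pos x hx) (hΨ.pos _ (sq_nonneg x)) (h x hx).1⟩⟩

theorem EssDecreasing.inv {Ψ : ℝ → ℝ} (hΨ : ClassL Ψ) (hd : EssDecreasing Ψ) :
    EssIncreasing (fun x => (Ψ x)⁻¹) := by
  obtain ⟨C, hC, h⟩ := hd
  refine ⟨C, hC, fun x y hx hxy => ?_⟩
  have hy := hΨ.pos y (hx.trans hxy)
  rw [← div_eq_mul_inv, le_div_iff₀ hy, inv_mul_le_iff₀ (hΨ.pos x hx)]
  linarith [h x y hx hxy]

theorem ClassL.pow_two_pow_le {Ψ : ℝ → ℝ} (hΨ : ClassL Ψ) :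
    ∃ D : ℝ, 1 ≤ D ∧ ∀ (n : ℕ) (x : ℝ), 0 ≤ x → Ψ (x ^ 2 ^ n) ≤ D ^ n * Ψ x := by
  obtain ⟨C, hC, h⟩ := hΨ.doubling
  refine ⟨max C 1, le_max_right _ _, fun n => ?_⟩
  induction n with
  | zero => intro x _; simp
  | succ n ih =>
    intro x hx
    have h1 := ih (x ^ 2) (sq_nonneg x)
    rw [← pow_mul, ← pow_succ'] at h1
    refine h1.trans ?_
    rw [pow_succ (max C 1), mul_assoc]
    have h2 : Ψ (x ^ 2) ≤ max C 1 * Ψ x :=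
      (h x hx).2.trans (mul_le_mul_of_nonneg_right (le_max_left _ _) (hΨ.pos x hx).le)
    exact mul_le_mul_of_nonneg_left h2 (by positivity)

/-- Polynomially dominated arguments give comparable values. -/
theorem EssIncreasing.le_of_le_rpow {Ψ : ℝ → ℝ} (hΨ : ClassL Ψ) (hi : EssIncreasing Ψ) {A N : ℝ}
    (hA : 0 < A) (hN : 0 < N) :
    ∃ C : ℝ, 0 < C ∧ ∀ x y : ℝ, 0 ≤ x → 0 ≤ y → y ≤ A * x ^ N → Ψ y ≤ C * Ψ x := by
  obtain ⟨C, hC, h⟩ := hi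
  obtain ⟨D, hD, hpow⟩ := hΨ.pow_two_pow_le
  -- For x ≥ max(A, 1) one has A x^N ≤ x^(1+N) ≤ x^(2^n), so n squarings suffice. Smaller x is
  -- handled by constants, using the lower bound Ψ(0)/C for Ψ(x).
  obtain ⟨n, hn⟩ := pow_unbounded_of_one_lt (1 + N) one_lt_two
  set B := max A 1
  have hB : 1 ≤ B := le_max_right _ _
  have hBA : 0 < Ψ (A * B ^ N) := hΨ.pos _ (by positivity)
  have h0 := hΨ.pos 0 le_rfl
  refine ⟨max (C * D ^ n) (C * Ψ (A * B ^ N) * (C / Ψ 0)), by positivity,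
    fun x y hx hy hxy => ?_⟩
  have hΨx := hΨ.pos x hx
  rcases le_total x B with hxB | hxB
  · have h1 : Ψ y ≤ C * Ψ (A * B ^ N) := h _ _ hy (hxy.trans (by gcongr))
    have h2 : 1 ≤ C / Ψ 0 * Ψ x := by
      rw [div_mul_eq_mul_div, le_div_iff₀ h0, one_mul]
      exact h 0 x le_rfl hx
    calc Ψ y ≤ C * Ψ (A * B ^ N) * 1 := by rw [mul_one]; exact h1
      _ ≤ C * Ψ (A * B ^ N) * (C / Ψ 0 * Ψ x) := by gcongr
      _ = C * Ψ (A * B ^ N) * (C / Ψ 0) * Ψ x := by ring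
      _ ≤ _ := mul_le_mul_of_nonneg_right (le_max_right _ _) hΨx.le
  · have hx1 : 1 ≤ x := hB.trans hxB
    have h1 : y ≤ x ^ 2 ^ n := by
      refine hxy.trans ?_
      calc A * x ^ N ≤ x * x ^ N := by gcongr; exact (le_max_left _ _).trans hxB
        _ = x ^ (1 + N) := by rw [Real.rpow_add (by linarith), Real.rpow_one]
        _ ≤ x ^ ((2 ^ n : ℕ) : ℝ) := Real.rpow_le_rpow_of_exponent_le hx1 (by push_cast; exact hn.le)
        _ = x ^ 2 ^ n := Real.rpow_natCast _ _
    calc Ψ y ≤ C * Ψ (x ^ 2 ^ n) := h _ _ hy h1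
      _ ≤ C * (D ^ n * Ψ x) := by gcongr; exact hpow n x hx
      _ = C * D ^ n * Ψ x := by ring
      _ ≤ _ := mul_le_mul_of_nonneg_right (le_max_left _ _) hΨx.le

theorem EssDecreasing.le_of_le_rpow {Ψ : ℝ → ℝ} (hΨ : ClassL Ψ) (hd : EssDecreasing Ψ) {A N : ℝ}
    (hA : 0 < A) (hN : 0 < N) :
    ∃ C : ℝ, 0 < C ∧ ∀ x y : ℝ, 0 ≤ x → 0 ≤ y → y ≤ A * x ^ N → Ψ x ≤ C * Ψ y := by
  obtain ⟨C, hC, h⟩ := (hd.inv hΨ).le_of_le_rpow hΨ.inv hA hN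
  refine ⟨C, hC, fun x y hx hy hxy => ?_⟩
  have h1 := h x y hx hy hxy
  rwa [← div_eq_mul_inv, le_div_iff₀ (hΨ.pos x hx), inv_mul_le_iff₀ (hΨ.pos y hy),
    mul_comm] at h1

/-- Functions in `𝓛` grow more slowly than any power. -/
theorem EssIncreasing.le_rpow {Ψ : ℝ → ℝ} (hΨ : ClassL Ψ) (hi : EssIncreasing Ψ) {ε : ℝ}
    (hε : 0 < ε) : ∃ A : ℝ, 0 < A ∧ ∀ t : ℝ, 1 ≤ t → Ψ t ≤ A * t ^ ε := by
  obtain ⟨C, hC, h⟩ := hi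
  obtain ⟨D, hD, hpow⟩ := hΨ.pow_two_pow_le
  set T := max 2 (D ^ (2 / ε))
  have hT : 2 ≤ T := le_max_left _ _
  have hTD (t : ℝ) (ht : T ≤ t) : D ≤ t ^ (ε / 2) := by
    calc D = (D ^ (2 / ε)) ^ (ε / 2) := by
          rw [← Real.rpow_mul (by linarith), div_mul_div_cancel₀ hε.ne', div_self two_ne_zero,
            Real.rpow_one]
      _ ≤ t ^ (ε / 2) := by
          gcongr
          exact (le_max_right _ _).trans ht
  have hΨT := hΨ.pos (T ^ 2) (by positivity)
  refine ⟨C * Ψ (T ^ 2), by positivity, ?_⟩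
  -- Induction on repeated square roots of t. The factor D lost in passing from t to √t is at most
  -- (√t)^ε once √t ≥ T, so the constant does not grow with n.
  have key (n : ℕ) : ∀ t : ℝ, 1 ≤ t → t ≤ T ^ 2 ^ n → Ψ t ≤ C * Ψ (T ^ 2) * t ^ ε := by
    induction n with
    | zero =>
      intro t ht htT
      have h1 : Ψ t ≤ C * Ψ (T ^ 2) := h _ _ (by linarith) (by
        rw [pow_zero, pow_one] at htT
        nlinarith)
      refine h1.trans (le_mul_of_one_le_right (by positivity) (Real.one_le_rpow ht hε.le))
    | succ n ih =>
      intro t ht htT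
      by_cases htT2 : t ≤ T ^ 2
      · exact (h _ _ (by linarith) htT2).trans
          (le_mul_of_one_le_right (by positivity) (Real.one_le_rpow ht hε.le))
      · have hsq : Real.sqrt t ^ 2 = t := Real.sq_sqrt (by linarith)
        have h1 : 1 ≤ Real.sqrt t := Real.one_le_sqrt.2 ht
        have h2 : Real.sqrt t ≤ T ^ 2 ^ n := by
          rw [Real.sqrt_le_left (by positivity), ← pow_mul, ← pow_succ]
          exact htT
        have h3 : T ≤ Real.sqrt t := Real.le_sqrt_of_sq_le (by linarith)
        have h4 := ih _ h1 h2
        have h5 := hpow 1 (Real.sqrt t) (Real.sqrt_nonneg t)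
        rw [pow_one, pow_one, hsq] at h5
        calc Ψ t ≤ D * Ψ (Real.sqrt t) := h5
          _ ≤ Real.sqrt t ^ ε * (C * Ψ (T ^ 2) * Real.sqrt t ^ ε) := by
              have h6 : D ≤ Real.sqrt t ^ ε := (hTD _ h3).trans
                (Real.rpow_le_rpow_of_exponent_le h1 (by linarith))
              have h7 := hΨ.pos _ (Real.sqrt_nonneg t)
              gcongr
          _ = C * Ψ (T ^ 2) * (Real.sqrt t ^ ε * Real.sqrt t ^ ε) := by ring
          _ = C * Ψ (T ^ 2) * t ^ ε := by
              rw [← Real.mul_rpow (Real.sqrt_nonneg t) (Real.sqrt_nonneg t), ← pow_two, hsq]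
  intro t ht
  obtain ⟨n, hn⟩ := pow_unbounded_of_one_lt t (one_lt_two.trans_le hT)
  exact key n t ht (hn.le.trans (pow_le_pow_right₀ (by linarith) Nat.lt_two_pow_self.le))

/-- If t ≤ x then tx ≤ x² and Ψ(tx) ≲ Ψ(x). If t ≥ x then tx ≤ t², so Ψ(tx) ≲ Ψ(t) ≲ t^ε, while Ψ(x)
≳ Ψ(0). The reverse inequality is monotonicity. -/
theorem EssIncreasing.le_mul_rpow {Ψ : ℝ → ℝ} (hΨ : ClassL Ψ) (hi : EssIncreasing Ψ) {ε : ℝ}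
    (hε : 0 < ε) :
    ∃ A : ℝ, 0 < A ∧ ∀ t x : ℝ, 1 ≤ t → 1 ≤ x →
      Ψ (t * x) ≤ A * t ^ ε * Ψ x ∧ Ψ x ≤ A * t ^ ε * Ψ (t * x) := by
  obtain ⟨B, hB, hpow⟩ := hi.le_rpow hΨ hε
  obtain ⟨E, hE, hK⟩ := hi.le_of_le_rpow hΨ one_pos two_pos
  obtain ⟨C, hC, h⟩ := hi
  have h0 := hΨ.pos 0 le_rfl
  refine ⟨max (max E (E * B * (C / Ψ 0))) C, by positivity, fun t x ht hx => ⟨?_, ?_⟩⟩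
  · have hΨx := hΨ.pos x (by linarith)
    have hte := Real.one_le_rpow ht hε.le
    rw [mul_assoc]
    refine le_trans ?_ (mul_le_mul_of_nonneg_right (le_max_left _ _) (by positivity))
    rcases le_total t x with htx | htx
    · have h1 : Ψ (t * x) ≤ E * Ψ x := hK x _ (by linarith) (by positivity) (by
        rw [one_mul, Real.rpow_two]; nlinarith)
      calc Ψ (t * x) ≤ E * Ψ x := h1
        _ ≤ E * (t ^ ε * Ψ x) := by
          gcongr
          exact le_mul_of_one_le_left hΨx.le hte
        _ ≤ _ := mul_le_mul_of_nonneg_right (le_max_left _ _) (by positivity)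
    · have h1 : Ψ (t * x) ≤ E * Ψ t := hK t _ (by linarith) (by positivity) (by
        rw [one_mul, Real.rpow_two]; nlinarith)
      have h2 : 1 ≤ C / Ψ 0 * Ψ x := by
        rw [div_mul_eq_mul_div, le_div_iff₀ h0, one_mul]
        exact h 0 x le_rfl (by linarith)
      calc Ψ (t * x) ≤ E * (B * t ^ ε) := h1.trans (by gcongr; exact hpow t ht)
        _ = E * (B * t ^ ε) * 1 := by ring
        _ ≤ E * (B * t ^ ε) * (C / Ψ 0 * Ψ x) := by gcongr
        _ = E * B * (C / Ψ 0) * (t ^ ε * Ψ x) := by ring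
        _ ≤ _ := mul_le_mul_of_nonneg_right (le_max_right _ _) (by positivity)
  · have hte := Real.one_le_rpow ht hε.le
    have hΨx := hΨ.pos (t * x) (by positivity)
    have h1 := h x (t * x) (by linarith) (by nlinarith)
    refine h1.trans (mul_le_mul_of_nonneg_right ?_ hΨx.le)
    refine le_trans (le_max_right _ _) (le_mul_of_one_le_right (by positivity) hte)

/-- A Potter-type bound for functions in `𝓛`. -/
theorem ClassL.le_mul_rpow {Ψ : ℝ → ℝ} (hΨ : ClassL Ψ) {ε : ℝ} (hε : 0 < ε) :
    ∃ A : ℝ, 0 < A ∧ ∀ t x : ℝ, 1 ≤ t → 1 ≤ x →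
      Ψ (t * x) ≤ A * t ^ ε * Ψ x ∧ Ψ x ≤ A * t ^ ε * Ψ (t * x) := by
  rcases hΨ.essMonotonic with hi | hd
  · exact hi.le_mul_rpow hΨ hε
  · obtain ⟨A, hA, h⟩ := (hd.inv hΨ).le_mul_rpow hΨ.inv hε
    refine ⟨A, hA, fun t x ht hx => ?_⟩
    have hx' := hΨ.pos x (by linarith)
    have htx := hΨ.pos (t * x) (by positivity)
    have key {a b c : ℝ} (ha : 0 < a) (hb : 0 < b) (h : a⁻¹ ≤ c * b⁻¹) : b ≤ c * a := by
      rwa [← div_eq_mul_inv, le_div_iff₀ hb, inv_mul_le_iff₀ ha, mul_comm] at h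
    exact ⟨key hx' htx (h t x ht hx).2, key htx hx' (h t x ht hx).1⟩

/-! ### Tail integrals of doubling weights -/

theorem pow_mul_tail_le {T : ℝ → ℝ≥0∞} {K C : ℝ} (hK : 1 < K) (hC : 1 < C)
    (h : ∀ r : ℝ, 0 ≤ r → r < 1 → ENNReal.ofReal C * T (1 - (1 - r) / K) ≤ T r) (n : ℕ) :
    ∀ r : ℝ, 0 ≤ r → r < 1 → ENNReal.ofReal (C ^ n) * T (1 - (1 - r) / K ^ n) ≤ T r := by
  have hK0 : 0 < K := by linarith
  induction n with
  | zero => intro r _ _; simp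
  | succ n ih =>
    intro r hr hr1
    have h1 : (1 - r) / K ^ n ≤ 1 - r :=
      div_le_self (by linarith) (one_le_pow₀ hK.le)
    have h2 : 0 < (1 - r) / K ^ n := div_pos (by linarith) (by positivity)
    have h3 := h (1 - (1 - r) / K ^ n) (by linarith) (by linarith)
    rw [sub_sub_cancel, div_div, ← pow_succ] at h3
    refine le_trans ?_ (ih r hr hr1)
    rw [pow_succ C, ENNReal.ofReal_mul (by positivity), mul_assoc]
    gcongr

/-- Lower doubling makes small negative powers of the distance to the boundary integrable, in a
scale invariant way. -/
theorem exists_lintegral_rpow_le {φ : ℝ → ℝ≥0∞} {K C : ℝ} (hK : 1 < K) (hC : 1 < C)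
    (h : ∀ r : ℝ, 0 ≤ r → r < 1 →
      ENNReal.ofReal C * ∫⁻ s in Set.Ico (1 - (1 - r) / K) 1, φ s ≤ ∫⁻ s in Set.Ico r 1, φ s) :
    ∃ ε A : ℝ, 0 < ε ∧ 0 < A ∧ K ^ ε < C ∧ ∀ r : ℝ, 0 ≤ r → r < 1 →
      ∫⁻ s in Set.Ico r 1, ENNReal.ofReal (((1 - r) / (1 - s)) ^ ε) * φ s ≤
        ENNReal.ofReal A * ∫⁻ s in Set.Ico r 1, φ s := by
  have hK0 : 0 < K := by linarith
  have hlogK : 0 < Real.log K := Real.log_pos hK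
  have hlogC : 0 < Real.log C := Real.log_pos hC
  -- This choice makes K^ε = √C, so the ratio K^ε/C of the geometric series below is less than 1.
  set ε := Real.log C / (2 * Real.log K) with hεdef
  have hε : 0 < ε := by positivity
  have hKε : K ^ ε < C := by
    rw [Real.rpow_def_of_pos hK0, ← Real.lt_log_iff_exp_lt (by linarith), hεdef]
    field_simp
    linarith
  set Q := K ^ ε
  have hQ : 0 < Q := by positivity
  have hq1 : Q / C < 1 := (div_lt_one (by linarith)).2 hKε
  have hq0 : 0 ≤ Q / C := by positivity
  have hsum : Summable fun n : ℕ => Q * (Q / C) ^ n :=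
    (summable_geometric_of_lt_one hq0 hq1).mul_left Q
  have hA : 0 < ∑' n : ℕ, Q * (Q / C) ^ n :=
    hsum.tsum_pos (fun n => by positivity) 0 (by simpa using hQ)
  refine ⟨ε, ∑' n : ℕ, Q * (Q / C) ^ n, hε, hA, hKε, fun r hr hr1 => ?_⟩
  set T := fun r => ∫⁻ s in Set.Ico r 1, φ s
  have hr1' : 0 < 1 - r := by linarith
  -- On J n the power of (1-r)/(1-s) is at most K^(ε(n+1)), whereas reverse doubling applied n times
  -- bounds the mass by C^(-n) times the tail at r.
  let J : ℕ → Set ℝ := fun n => Set.Ico (1 - (1 - r) / K ^ n) (1 - (1 - r) / K ^ (n + 1))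
  have hcover : Set.Ico r 1 ⊆ ⋃ n, J n := by
    intro s hs
    have hs1 : 0 < 1 - s := by linarith [hs.2]
    have hy : 1 ≤ (1 - r) / (1 - s) := by rw [one_le_div hs1]; linarith [hs.1]
    obtain ⟨n, hn1, hn2⟩ := exists_nat_pow_near hy hK
    rw [le_div_iff₀ hs1] at hn1
    rw [div_lt_iff₀ hs1] at hn2
    refine Set.mem_iUnion.2 ⟨n, ?_, ?_⟩
    · rw [sub_le_comm, le_div_iff₀ (by positivity)]; linarith
    · rw [lt_sub_comm, div_lt_iff₀ (by positivity)]; linarith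
  have hpiece (n : ℕ) : ∫⁻ s in J n, ENNReal.ofReal (((1 - r) / (1 - s)) ^ ε) * φ s ≤
      ENNReal.ofReal (Q * (Q / C) ^ n) * T r := by
    have h1 : ∫⁻ s in J n, ENNReal.ofReal (((1 - r) / (1 - s)) ^ ε) * φ s ≤
        ∫⁻ s in J n, ENNReal.ofReal (Q ^ (n + 1)) * φ s := by
      refine setLIntegral_mono' measurableSet_Ico fun s hs => ?_
      have hs2 := hs.2
      have hp : 0 < (1 - r) / K ^ (n + 1) := by positivity
      have hs1 : 0 < 1 - s := by linarith
      gcongr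
      have h2 : (1 - r) / (1 - s) ≤ K ^ (n + 1) := by
        rw [lt_sub_comm, div_lt_iff₀ (by positivity)] at hs2
        rw [div_le_iff₀ hs1]
        linarith
      calc ((1 - r) / (1 - s)) ^ ε ≤ (K ^ (n + 1)) ^ ε := by gcongr
        _ = Q ^ (n + 1) := by
          rw [← Real.rpow_natCast, ← Real.rpow_natCast, ← Real.rpow_mul hK0.le,
            ← Real.rpow_mul hK0.le, mul_comm]
    rw [lintegral_const_mul' _ _ ENNReal.ofReal_ne_top] at h1
    have h3 : ∫⁻ s in J n, φ s ≤ T (1 - (1 - r) / K ^ n) := by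
      refine lintegral_mono_set fun s hs => ⟨hs.1, hs.2.trans ?_⟩
      have : 0 < (1 - r) / K ^ (n + 1) := by positivity
      linarith
    have h4 := pow_mul_tail_le (T := T) hK hC h n r hr hr1
    refine h1.trans ?_
    calc ENNReal.ofReal (Q ^ (n + 1)) * ∫⁻ s in J n, φ s
        ≤ ENNReal.ofReal (Q ^ (n + 1)) * T (1 - (1 - r) / K ^ n) := by gcongr
      _ = ENNReal.ofReal (Q * (Q / C) ^ n) *
          (ENNReal.ofReal (C ^ n) * T (1 - (1 - r) / K ^ n)) := by
        rw [← mul_assoc, ← ENNReal.ofReal_mul (by positivity)]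
        rw [div_pow, mul_assoc, div_mul_cancel₀ _ (by positivity), pow_succ']
      _ ≤ _ := by gcongr
  calc ∫⁻ s in Set.Ico r 1, ENNReal.ofReal (((1 - r) / (1 - s)) ^ ε) * φ s
      ≤ ∫⁻ s in ⋃ n, J n, ENNReal.ofReal (((1 - r) / (1 - s)) ^ ε) * φ s :=
        lintegral_mono_set hcover
    _ ≤ ∑' n, ∫⁻ s in J n, ENNReal.ofReal (((1 - r) / (1 - s)) ^ ε) * φ s :=
        lintegral_iUnion_le _ _
    _ ≤ ∑' n, ENNReal.ofReal (Q * (Q / C) ^ n) * T r := ENNReal.tsum_le_tsum hpiece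
    _ = _ := by
      rw [ENNReal.tsum_mul_right, ENNReal.ofReal_tsum_of_nonneg (fun n => by positivity) hsum]

theorem ClassL.radial_le {Ψ : ℝ → ℝ} (hΨ : ClassL Ψ) {ε : ℝ} (hε : 0 < ε) :
    ∃ A : ℝ, 0 < A ∧ ∀ r s : ℝ, 0 ≤ r → r ≤ s → s < 1 →
      Ψ (1 / (1 - s)) ≤ A * ((1 - r) / (1 - s)) ^ ε * Ψ (1 / (1 - r)) ∧
      Ψ (1 / (1 - r)) ≤ A * ((1 - r) / (1 - s)) ^ ε * Ψ (1 / (1 - s)) := by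
  obtain ⟨A, hA, h⟩ := hΨ.le_mul_rpow hε
  refine ⟨A, hA, fun r s hr hrs hs => ?_⟩
  have hs1 : 0 < 1 - s := by linarith
  have hr1 : 0 < 1 - r := by linarith
  have := h ((1 - r) / (1 - s)) (1 / (1 - r)) (by rw [one_le_div hs1]; linarith)
    (by rw [one_le_div hr1]; linarith)
  rwa [div_mul_div_cancel₀' hr1.ne'] at this

theorem tail_auxWeight {ω : ℂ → ℝ} {Ψ : ℝ → ℝ} (hΨ : ClassL Ψ) {r : ℝ} (hr : 0 ≤ r) :
    tail (auxWeight ω Ψ) r =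
      ∫⁻ s in Set.Ico r 1, ENNReal.ofReal (Ψ (1 / (1 - s))) * ENNReal.ofReal (ω (s : ℂ)) := by
  refine setLIntegral_congr_fun measurableSet_Ico fun s hs => ?_
  have hs0 : 0 ≤ s := hr.trans hs.1
  have hs1 : 0 < 1 - s := by linarith [hs.2]
  have hn : ‖(s : ℂ)‖ = s := by rw [Complex.norm_real, Real.norm_of_nonneg hs0]
  simp only [auxWeight, hn]
  rw [ENNReal.ofReal_mul (hΨ.pos _ (by positivity)).le]

/-- The tail integral of the auxiliary weight is comparable to `Ψ (1 / (1 - r))` times the tail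
integral of the weight. -/
theorem exists_tail_auxWeight_comparable {ω : ℂ → ℝ} {Ψ : ℝ → ℝ} (hΨ : ClassL Ψ)
    (hω : ClassDCheck ω) (hfin : tail ω 0 ≠ ∞) :
    ∃ B : ℝ, 0 < B ∧ ∀ r : ℝ, 0 ≤ r → r < 1 →
      tail (auxWeight ω Ψ) r ≤ ENNReal.ofReal (B * Ψ (1 / (1 - r))) * tail ω r ∧
      ENNReal.ofReal (Ψ (1 / (1 - r))) * tail ω r ≤
        ENNReal.ofReal B * tail (auxWeight ω Ψ) r := by
  obtain ⟨-, K, C, hK, hC, hd⟩ := hω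
  have hK0 : 0 < K := by linarith
  obtain ⟨ε, A, hε, hA, -, hint⟩ := exists_lintegral_rpow_le hK hC hd
  obtain ⟨A', hA', hP⟩ := hΨ.radial_le hε
  have hC1 : 0 < C - 1 := by linarith
  refine ⟨max (A' * A) (C / (C - 1) * (A' * K ^ ε)), by positivity, fun r hr hr1 => ?_⟩
  have hr1' : 0 < 1 - r := by linarith
  have hψ := hΨ.pos (1 / (1 - r)) (by positivity)
  have hmono {a b : ℝ} (ha : 0 ≤ a) (hab : a ≤ b) : tail ω b ≤ tail ω a :=
    lintegral_mono_set (Set.Ico_subset_Ico_left hab)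
  have hfin' {a : ℝ} (ha : 0 ≤ a) : tail ω a ≠ ∞ := ne_top_of_le_ne_top hfin (hmono le_rfl ha)
  constructor
  · rw [tail_auxWeight hΨ hr]
    calc ∫⁻ s in Set.Ico r 1, ENNReal.ofReal (Ψ (1 / (1 - s))) * ENNReal.ofReal (ω (s : ℂ))
        ≤ ∫⁻ s in Set.Ico r 1, ENNReal.ofReal (A' * Ψ (1 / (1 - r))) *
            (ENNReal.ofReal (((1 - r) / (1 - s)) ^ ε) * ENNReal.ofReal (ω (s : ℂ))) := by
          refine setLIntegral_mono' measurableSet_Ico fun s hs => ?_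
          rw [← mul_assoc, ← ENNReal.ofReal_mul (p := A' * _) (by positivity)]
          gcongr
          linarith [(hP r s hr hs.1 hs.2).1]
      _ ≤ ENNReal.ofReal (A' * Ψ (1 / (1 - r))) * (ENNReal.ofReal A * tail ω r) := by
          rw [lintegral_const_mul' _ _ ENNReal.ofReal_ne_top]
          gcongr
          exact hint r hr hr1
      _ = ENNReal.ofReal (A' * A * Ψ (1 / (1 - r))) * tail ω r := by
          rw [← mul_assoc, ← ENNReal.ofReal_mul (by positivity)]
          congr 2
          ring
      _ ≤ _ := by gcongr; exact le_max_left _ _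
  -- Reverse doubling places a fixed proportion of the mass of [r, 1) in [r, r₁), where (1-r)/(1-s)
  -- ≤ K and hence Ψ(1/(1-s)) is comparable to Ψ(1/(1-r)).
  · set r₁ := 1 - (1 - r) / K with hr₁
    have hdiv : (1 - r) / K ≤ 1 - r := div_le_self hr1'.le hK.le
    have hdiv0 : 0 < (1 - r) / K := by positivity
    have hrr₁ : r ≤ r₁ := by linarith
    have hr₁1 : r₁ < 1 := by linarith
    set I := ∫⁻ s in Set.Ico r r₁, ENNReal.ofReal (ω (s : ℂ))
    have hsplit : tail ω r = I + tail ω r₁ := by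
      rw [tail, ← Set.Ico_union_Ico_eq_Ico hrr₁ hr₁1.le,
        lintegral_union measurableSet_Ico (Set.Ico_disjoint_Ico_same)]
      rfl
    have hIfin : I ≠ ∞ := ne_top_of_le_ne_top (hfin' hr) (hsplit ▸ le_self_add)
    have hT : tail ω r ≤ ENNReal.ofReal (C / (C - 1)) * I := by
      have h1 := hd r hr hr1
      have h1' := ENNReal.toReal_mono (hfin' hr) h1
      rw [ENNReal.toReal_mul, ENNReal.toReal_ofReal (by linarith)] at h1'
      have h2 := congrArg ENNReal.toReal hsplit
      rw [ENNReal.toReal_add hIfin (hfin' (hr.trans hrr₁))] at h2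
      rw [← ENNReal.ofReal_toReal hIfin, ← ENNReal.ofReal_toReal (hfin' hr),
        ← ENNReal.ofReal_mul (by positivity)]
      refine ENNReal.ofReal_le_ofReal ?_
      rw [div_mul_eq_mul_div, le_div_iff₀ hC1]
      nlinarith
    have hI : ENNReal.ofReal (Ψ (1 / (1 - r))) * I ≤
        ENNReal.ofReal (A' * K ^ ε) * tail (auxWeight ω Ψ) r := by
      rw [tail_auxWeight hΨ hr, ← lintegral_const_mul' _ _ ENNReal.ofReal_ne_top,
        ← lintegral_const_mul' _ _ ENNReal.ofReal_ne_top]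
      refine (setLIntegral_mono' measurableSet_Ico fun s hs => ?_).trans
        (lintegral_mono_set (Set.Ico_subset_Ico_right hr₁1.le))
      rw [← mul_assoc, ← ENNReal.ofReal_mul (p := A' * _) (by positivity)]
      have hs1 : 0 < 1 - s := by linarith [hs.2]
      have hψs := hΨ.pos (1 / (1 - s)) (by positivity)
      have h2 : (1 - r) / (1 - s) ≤ K := by
        rw [div_le_iff₀ hs1, mul_comm, ← div_le_iff₀ hK0]
        linarith [hs.2]
      gcongr
      refine (hP r s hr hs.1 (by linarith)).2.trans ?_
      gcongr
    calc ENNReal.ofReal (Ψ (1 / (1 - r))) * tail ω r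
        ≤ ENNReal.ofReal (Ψ (1 / (1 - r))) * (ENNReal.ofReal (C / (C - 1)) * I) := by gcongr
      _ = ENNReal.ofReal (C / (C - 1)) * (ENNReal.ofReal (Ψ (1 / (1 - r))) * I) := by ring
      _ ≤ ENNReal.ofReal (C / (C - 1)) *
          (ENNReal.ofReal (A' * K ^ ε) * tail (auxWeight ω Ψ) r) := by gcongr
      _ = ENNReal.ofReal (C / (C - 1) * (A' * K ^ ε)) * tail (auxWeight ω Ψ) r := by
          rw [← mul_assoc, ← ENNReal.ofReal_mul (by positivity)]
      _ ≤ _ := by gcongr; exact le_max_right _ _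

/-- Upper doubling gives a polynomial lower bound for tail integrals. -/
theorem exists_rpow_le_tail {ω : ℂ → ℝ} (hω : ClassDHat ω) (hfin : tail ω 0 ≠ ∞) :
    ∃ c γ : ℝ, 0 < c ∧ 0 ≤ γ ∧ ∀ r : ℝ, 0 ≤ r → r < 1 →
      ENNReal.ofReal (c * (1 - r) ^ γ) ≤ tail ω r := by
  obtain ⟨hw, C, hC, hd⟩ := hω
  have hiter (n : ℕ) : tail ω 0 ≤ ENNReal.ofReal (C ^ n) * tail ω (1 - (1 / 2) ^ n) := by
    induction n with
    | zero => simp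
    | succ n ih =>
      have h1 : ((1 : ℝ) / 2) ^ n ≤ 1 := pow_le_one₀ (by norm_num) (by norm_num)
      have h2 := hd (1 - (1 / 2) ^ n) (by linarith) (by
        have : (0 : ℝ) < (1 / 2) ^ n := by positivity
        linarith)
      have h3 : (1 + (1 - (1 / 2) ^ n)) / 2 = 1 - ((1 : ℝ) / 2) ^ (n + 1) := by
        rw [pow_succ]; ring
      rw [h3] at h2
      calc tail ω 0 ≤ _ := ih
        _ ≤ ENNReal.ofReal (C ^ n) * (ENNReal.ofReal C * tail ω (1 - (1 / 2) ^ (n + 1))) := by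
          gcongr
        _ = _ := by
          rw [← mul_assoc, ← ENNReal.ofReal_mul (by positivity), ← pow_succ]
  set t := (tail ω 0).toReal with ht
  have ht0 : 0 < t := ENNReal.toReal_pos (hw.tail_pos 0 le_rfl one_pos).ne' hfin
  -- The exponent for which (2^(-n))^γ = C^(-n), matching n applications of upper doubling.
  set γ := Real.logb 2 C
  have hγ : 0 ≤ γ := Real.logb_nonneg one_lt_two hC
  refine ⟨t / C, γ, by positivity, hγ, fun r hr hr1 => ?_⟩
  have hr1' : 0 < 1 - r := by linarith
  obtain ⟨n, hn1, hn2⟩ := exists_nat_pow_near (x := 1 / (1 - r)) (y := (2 : ℝ))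
    (by rw [one_le_div hr1']; linarith) one_lt_two
  rw [div_lt_iff₀ hr1'] at hn2
  rw [le_div_iff₀ hr1'] at hn1
  have hmono : tail ω (1 - (1 / 2) ^ (n + 1)) ≤ tail ω r := by
    refine lintegral_mono_set (Set.Ico_subset_Ico_left ?_)
    rw [one_div_pow, le_sub_comm, div_le_iff₀ (by positivity)]
    linarith
  have h1 : (1 - r) ^ γ ≤ 1 / C ^ n := by
    have h2 : 1 - r ≤ 1 / 2 ^ n := by
      rw [le_div_iff₀ (by positivity)]; linarith
    calc (1 - r) ^ γ ≤ (1 / 2 ^ n) ^ γ := by gcongr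
      _ = 1 / C ^ n := by
        rw [Real.div_rpow zero_le_one (by positivity), Real.one_rpow, ← Real.rpow_natCast,
          ← Real.rpow_mul zero_le_two, mul_comm, Real.rpow_mul zero_le_two,
          Real.rpow_logb two_pos (by norm_num) (by linarith), Real.rpow_natCast]
  have h3 : ENNReal.ofReal (t / C ^ (n + 1)) ≤ tail ω (1 - (1 / 2) ^ (n + 1)) := by
    have h4 := hiter (n + 1)
    rw [← ENNReal.ofReal_toReal hfin, ← ht] at h4
    rw [ENNReal.ofReal_div_of_pos (by positivity)]
    exact ENNReal.div_le_of_le_mul' h4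
  refine le_trans (ENNReal.ofReal_le_ofReal ?_) (h3.trans hmono)
  calc t / C * (1 - r) ^ γ ≤ t / C * (1 / C ^ n) := by gcongr
    _ = t / C ^ (n + 1) := by rw [pow_succ]; field_simp

/-! ### Polar coordinates and pointwise estimates -/

theorem measurableSet_disc : MeasurableSet disc := Metric.isOpen_ball.measurableSet

theorem mem_disc {z : ℂ} : z ∈ disc ↔ ‖z‖ < 1 := by simp [disc]

theorem ofReal_pi_inv_ne_zero : (ENNReal.ofReal Real.pi)⁻¹ ≠ 0 :=
  ENNReal.inv_ne_zero.2 ENNReal.ofReal_ne_top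

theorem aemeasurable_areaMeasure_iff {β : Type*} [MeasurableSpace β] {F : ℂ → β} :
    AEMeasurable F areaMeasure ↔ AEMeasurable F (volume.restrict disc) :=
  aemeasurable_smul_measure_iff ofReal_pi_inv_ne_zero

theorem ae_areaMeasure_of_forall {P : ℂ → Prop} (h : ∀ z ∈ disc, P z) : ∀ᵐ z ∂areaMeasure, P z :=
  Measure.ae_smul_measure (ae_restrict_of_forall_mem measurableSet_disc h) _

theorem measurable_polarCoord_symm : Measurable fun x => Complex.polarCoord.symm x := by
  simp only [Complex.polarCoord_symm_apply]
  fun_prop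

/-- The change of variables integrates the indicator of a null set against r dr dθ, and r > 0 on the
target. This carries a.e. measurability through polar coordinates. -/
theorem ae_polarCoord_symm {P : ℂ → Prop} (h : ∀ᵐ z : ℂ, P z) :
    ∀ᵐ x ∂(volume.restrict polarCoord.target), P (Complex.polarCoord.symm x) := by
  set N := toMeasurable volume {z : ℂ | ¬ P z}
  have hN : MeasurableSet N := measurableSet_toMeasurable _ _
  have hN0 : volume N = 0 := by rw [measure_toMeasurable]; exact h
  have h1 := Complex.lintegral_comp_polarCoord_symm (N.indicator 1)
  rw [lintegral_indicator_one hN, hN0, lintegral_eq_zero_iff] at h1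
  · filter_upwards [h1, ae_restrict_mem polarCoord.open_target.measurableSet] with x hx hxt
    by_contra hP
    have hmem : Complex.polarCoord.symm x ∈ N := subset_toMeasurable _ _ hP
    have hx1 : 0 < x.1 := hxt.1
    rw [Set.indicator_of_mem hmem] at hx
    simp at hx
    linarith
  · refine Measurable.mul (by fun_prop) ?_
    refine (measurable_one.indicator hN).comp ?_
    exact measurable_polarCoord_symm

theorem AEMeasurable.comp_polarCoord_symm {F : ℂ → ℝ≥0∞} (hF : AEMeasurable F) :
    AEMeasurable (fun x => F (Complex.polarCoord.symm x)) (volume.restrict polarCoord.target) :=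
  ⟨fun x => hF.mk F (Complex.polarCoord.symm x),
    hF.measurable_mk.comp measurable_polarCoord_symm,
    ae_polarCoord_symm hF.ae_eq_mk⟩

/-- Integration in polar coordinates over the unit disc. -/
theorem lintegral_areaMeasure_eq {F : ℂ → ℝ≥0∞} (hF : AEMeasurable F areaMeasure) :
    ∫⁻ z, F z ∂areaMeasure = (ENNReal.ofReal Real.pi)⁻¹ *
      ∫⁻ s in Set.Ioo (0 : ℝ) 1, ENNReal.ofReal s *
        ∫⁻ t in Set.Ioo (-Real.pi) Real.pi, F (Complex.polarCoord.symm (s, t)) := by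
  rw [areaMeasure, lintegral_smul_measure, smul_eq_mul, ← lintegral_indicator measurableSet_disc]
  congr 1
  have hF0 : AEMeasurable (disc.indicator F) :=
    (aemeasurable_indicator_iff measurableSet_disc).2 (aemeasurable_areaMeasure_iff.1 hF)
  have hmeas := AEMeasurable.comp_polarCoord_symm hF0
  have htarget : (volume : Measure (ℝ × ℝ)).restrict polarCoord.target =
      ((volume : Measure ℝ).restrict (Set.Ioi 0)).prod
        ((volume : Measure ℝ).restrict (Set.Ioo (-Real.pi) Real.pi)) := by
    rw [polarCoord_target, Measure.volume_eq_prod, Measure.prod_restrict]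
  rw [← Complex.lintegral_comp_polarCoord_symm]
  rw [htarget] at hmeas ⊢
  simp only [smul_eq_mul]
  rw [lintegral_prod _ (AEMeasurable.fun_mul (by fun_prop) hmeas)]
  have hInt : Set.Ioo (0 : ℝ) 1 = Set.Iio 1 ∩ Set.Ioi 0 := by
    rw [Set.inter_comm]; rfl
  rw [hInt, ← setLIntegral_indicator measurableSet_Iio]
  refine setLIntegral_congr_fun measurableSet_Ioi fun s hs => ?_
  rw [lintegral_const_mul' _ _ ENNReal.ofReal_ne_top]
  have hnorm (t : ℝ) : ‖Complex.polarCoord.symm (s, t)‖ = s := by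
    rw [Complex.norm_polarCoord_symm]; exact abs_of_pos hs
  by_cases hs1 : s < 1
  · rw [Set.indicator_of_mem (show s ∈ Set.Iio 1 from hs1)]
    congr 1
    refine lintegral_congr fun t => ?_
    rw [Set.indicator_of_mem]
    rw [mem_disc, hnorm]; exact hs1
  · rw [Set.indicator_of_notMem (show s ∉ Set.Iio 1 from hs1)]
    simp [Set.indicator, mem_disc, abs_of_pos (show 0 < s from hs),
      hs1]

theorem IsRadialWeight.aemeasurable {ω : ℂ → ℝ} (hω : IsRadialWeight ω) :
    AEMeasurable ω areaMeasure := hω.integrable.aestronglyMeasurable.aemeasurable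

/-- The density is finite, which makes measurability of F unnecessary. -/
theorem IsRadialWeight.lintegral_weightMeasure {ω : ℂ → ℝ} (hω : IsRadialWeight ω)
    (F : ℂ → ℝ≥0∞) :
    ∫⁻ z, F z ∂weightMeasure ω = ∫⁻ z, ENNReal.ofReal (ω z) * F z ∂areaMeasure :=
  lintegral_withDensity_eq_lintegral_mul_non_measurable₀ _ hω.aemeasurable.ennreal_ofReal
    (Eventually.of_forall fun _ => ENNReal.ofReal_lt_top) F

theorem IsRadialWeight.apply_polarCoord_symm {ω : ℂ → ℝ} (hω : IsRadialWeight ω) {s : ℝ}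
    (hs : s ∈ Set.Ioo (0 : ℝ) 1) (t : ℝ) : ω (Complex.polarCoord.symm (s, t)) = ω (s : ℂ) := by
  have hn : ‖Complex.polarCoord.symm (s, t)‖ = s := by
    rw [Complex.norm_polarCoord_symm]; exact abs_of_pos hs.1
  rw [hω.radial _ (by rw [mem_disc, hn]; exact hs.2), hn]

theorem IsRadialWeight.lintegral_eq {ω : ℂ → ℝ} (hω : IsRadialWeight ω) {F : ℂ → ℝ≥0∞}
    (hF : AEMeasurable F areaMeasure) :
    ∫⁻ z, F z ∂weightMeasure ω = (ENNReal.ofReal Real.pi)⁻¹ *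
      ∫⁻ s in Set.Ioo (0 : ℝ) 1, ENNReal.ofReal s * (ENNReal.ofReal (ω (s : ℂ)) *
        ∫⁻ t in Set.Ioo (-Real.pi) Real.pi, F (Complex.polarCoord.symm (s, t))) := by
  rw [hω.lintegral_weightMeasure, lintegral_areaMeasure_eq (hω.aemeasurable.ennreal_ofReal.fun_mul hF)]
  congr 1
  refine setLIntegral_congr_fun measurableSet_Ioo fun s hs => ?_
  simp only [hω.apply_polarCoord_symm hs]
  rw [lintegral_const_mul' _ _ ENNReal.ofReal_ne_top]

theorem IsRadialWeight.lintegral_radial_le {ω : ℂ → ℝ} (hω : IsRadialWeight ω) {g : ℝ → ℝ≥0∞}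
    (hg : Measurable g) :
    ∫⁻ z, g ‖z‖ ∂weightMeasure ω ≤
      2 * ∫⁻ s in Set.Ico (0 : ℝ) 1, g s * ENNReal.ofReal (ω (s : ℂ)) := by
  rw [hω.lintegral_eq (F := fun z => g ‖z‖) (hg.comp measurable_norm).aemeasurable]
  have hpi : (ENNReal.ofReal Real.pi)⁻¹ * ENNReal.ofReal (2 * Real.pi) = 2 := by
    rw [mul_comm 2, ENNReal.ofReal_mul Real.pi_pos.le, ← mul_assoc,
      ENNReal.inv_mul_cancel (ENNReal.ofReal_pos.2 Real.pi_pos).ne' ENNReal.ofReal_ne_top]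
    simp
  rw [← hpi, mul_assoc, ← lintegral_const_mul' _ _ ENNReal.ofReal_ne_top]
  refine mul_le_mul_right ?_ _
  refine (setLIntegral_mono' measurableSet_Ioo fun s hs => ?_).trans
    (lintegral_mono_set Set.Ioo_subset_Ico_self)
  simp only [Complex.norm_polarCoord_symm, abs_of_pos hs.1, lintegral_const,
    Measure.restrict_apply MeasurableSet.univ, Set.univ_inter, Real.volume_Ioo]
  calc ENNReal.ofReal s * (ENNReal.ofReal (ω s) * (g s * ENNReal.ofReal (Real.pi - -Real.pi)))
      ≤ 1 * (ENNReal.ofReal (ω s) * (g s * ENNReal.ofReal (Real.pi - -Real.pi))) := by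
        gcongr
        exact ENNReal.ofReal_le_one.2 hs.2.le
    _ = _ := by
        rw [show Real.pi - -Real.pi = 2 * Real.pi by ring]
        ring

theorem circleMap_zero_eq_polarCoord_symm (s t : ℝ) :
    circleMap 0 s t = Complex.polarCoord.symm (s, t) := by
  rw [Complex.polarCoord_symm_apply, circleMap, zero_add, Complex.exp_mul_I, Complex.ofReal_cos,
    Complex.ofReal_sin]

open Real in
theorem ofReal_circleAverage_eq {u : ℂ → ℝ} {s : ℝ} (hs : 0 ≤ s)
    (hu : ContinuousOn u (Metric.sphere 0 s)) (hu0 : ∀ z, 0 ≤ u z) :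
    ENNReal.ofReal (circleAverage u 0 s) = ENNReal.ofReal (1 / (2 * π)) *
      ∫⁻ t in Set.Ioo (-π) π, ENNReal.ofReal (u (Complex.polarCoord.symm (s, t))) := by
  have h1 : circleAverage u 0 s = (2 * π)⁻¹ * ∫ θ in (-π)..π, u (circleMap 0 s θ) := by
    rw [circleAverage_eq_integral_add (-π),
      intervalIntegral.integral_comp_add_right (fun θ => u (circleMap 0 s θ)), smul_eq_mul]
    congr 2 <;> ring
  have hc : Continuous fun θ => u (circleMap 0 s θ) :=
    hu.comp_continuous (continuous_circleMap 0 s) fun θ => circleMap_mem_sphere 0 hs θ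
  rw [h1, intervalIntegral.integral_of_le (by linarith [pi_pos]), integral_Ioc_eq_integral_Ioo,
    ENNReal.ofReal_mul (by positivity), ofReal_integral_eq_lintegral_ofReal, one_div]
  · simp only [circleMap_zero_eq_polarCoord_symm]
  · exact (hc.integrableOn_Icc (a := -π) (b := π)).mono_set Set.Ioo_subset_Icc_self
  · exact Eventually.of_forall fun θ => hu0 _

theorem AnalyticOnNhd.aemeasurable_disc {f : ℂ → ℂ} (hf : AnalyticOnNhd ℂ f disc) :
    AEMeasurable f areaMeasure :=
  aemeasurable_areaMeasure_iff.2 (hf.continuousOn.aemeasurable measurableSet_disc)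

open Real in
theorem IsRadialWeight.norm_rpow_mul_tail_le {ω : ℂ → ℝ} (hω : IsRadialWeight ω) {f : ℂ → ℂ}
    (hf : AnalyticOnNhd ℂ f disc) {q : ℝ} (hq : 0 < q) {w : ℂ} (hw : w ∈ disc) :
    ENNReal.ofReal (‖f w‖ ^ q * ((1 - ‖w‖) / 2)) * tail ω ((1 + ‖w‖) / 2) ≤
      ∫⁻ z, ENNReal.ofReal (‖f z‖ ^ q) ∂weightMeasure ω := by
  have hw1 : ‖w‖ < 1 := mem_disc.1 hw
  have hw0 := norm_nonneg w
  have hmeas : AEMeasurable (fun z => ENNReal.ofReal (‖f z‖ ^ q)) areaMeasure :=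
    ((AnalyticOnNhd.aemeasurable_disc hf).norm.pow_const q).ennreal_ofReal
  rw [hω.lintegral_eq hmeas, tail, ← lintegral_const_mul' _ _ ENNReal.ofReal_ne_top,
    ← lintegral_const_mul' _ _ (ENNReal.inv_ne_top.2 (by simpa using pi_pos)),
    Measure.restrict_congr_set (Ioo_ae_eq_Ico (a := (1 + ‖w‖) / 2) (b := 1)).symm]
  -- The circle estimate is multiplied by ω(s) and integrated over s > (1+|w|)/2, where s - |w| ≥
  -- (1-|w|)/2.
  refine (setLIntegral_mono' measurableSet_Ioo fun s hs => ?_).trans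
    (lintegral_mono_set (Set.Ioo_subset_Ioo_left (by linarith)))
  have hs0 : 0 < s := by linarith [hs.1]
  have hsw : (1 - ‖w‖) / 2 ≤ s - ‖w‖ := by linarith [hs.1]
  have hsw0 : 0 < s - ‖w‖ := by linarith
  have hsub : Metric.closedBall (0 : ℂ) s ⊆ disc := Metric.closedBall_subset_ball hs.2
  have h1 := norm_rpow_le_mul_circleAverage hq (hf.mono hsub) (w := w) (by simp; linarith [hs.1])
  have hcont : ContinuousOn (fun z => ‖f z‖ ^ q) (Metric.sphere 0 s) :=
    (hf.continuousOn.mono (Metric.sphere_subset_closedBall.trans hsub)).norm.rpow_const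
      fun _ _ => Or.inr hq.le
  have h2 := ofReal_circleAverage_eq hs0.le hcont fun z => by positivity
  set I := ∫⁻ t in Set.Ioo (-π) π, ENNReal.ofReal (‖f (Complex.polarCoord.symm (s, t))‖ ^ q)
  have h3 : ENNReal.ofReal (‖f w‖ ^ q) ≤
      ENNReal.ofReal (s / (s - ‖w‖)) * (ENNReal.ofReal (1 / (2 * π)) * I) := by
    rw [← h2, ← ENNReal.ofReal_mul (by positivity)]
    exact ENNReal.ofReal_le_ofReal h1
  calc ENNReal.ofReal (‖f w‖ ^ q * ((1 - ‖w‖) / 2)) * ENNReal.ofReal (ω s)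
      = ENNReal.ofReal ((1 - ‖w‖) / 2) * ENNReal.ofReal (‖f w‖ ^ q) * ENNReal.ofReal (ω s) := by
        rw [mul_comm (‖f w‖ ^ q), ENNReal.ofReal_mul (by linarith)]
    _ ≤ ENNReal.ofReal (s - ‖w‖) *
        (ENNReal.ofReal (s / (s - ‖w‖)) * (ENNReal.ofReal (1 / (2 * π)) * I)) *
          ENNReal.ofReal (ω s) := by gcongr
    _ = ENNReal.ofReal ((s - ‖w‖) * (s / (s - ‖w‖)) * (1 / (2 * π))) * (ENNReal.ofReal (ω s) * I) := by
        rw [ENNReal.ofReal_mul (by positivity), ENNReal.ofReal_mul (by positivity)]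
        ring
    _ ≤ ENNReal.ofReal (π⁻¹ * s) * (ENNReal.ofReal (ω s) * I) := by
        have h4 : (s - ‖w‖) * (s / (s - ‖w‖)) * (1 / (2 * π)) ≤ π⁻¹ * s := by
          rw [mul_div_cancel₀ _ hsw0.ne', mul_comm, one_div]
          gcongr
          linarith [pi_pos]
        exact mul_le_mul_left (ENNReal.ofReal_le_ofReal h4) _
    _ = _ := by
        rw [ENNReal.ofReal_mul (by positivity), ENNReal.ofReal_inv_of_pos pi_pos]
        ring

theorem IsRadialWeight.measure_univ_lt_top {ω : ℂ → ℝ} (hω : IsRadialWeight ω) :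
    weightMeasure ω Set.univ < ∞ := by
  rw [weightMeasure, withDensity_apply _ MeasurableSet.univ, Measure.restrict_univ]
  exact (lintegral_ofReal_le_lintegral_enorm ω).trans_lt hω.integrable.2

/-- Area integrability controls the tail only away from the origin, where the polar factor s
degenerates. It bounds the tail at 1/2, and upper doubling at r = 0 gives the rest. -/
theorem ClassDHat.tail_zero_ne_top {ω : ℂ → ℝ} (hω : ClassDHat ω) : tail ω 0 ≠ ∞ := by
  obtain ⟨hw, C, hC, hd⟩ := hω
  have h1 := hw.norm_rpow_mul_tail_le (f := fun _ => 1) analyticOnNhd_const one_pos (w := 0)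
    (by simp [disc])
  simp only [norm_one, Real.one_rpow, norm_zero, ENNReal.ofReal_one, lintegral_one] at h1
  have h2 := h1.trans_lt hw.measure_univ_lt_top
  have h3 : tail ω ((1 + 0) / 2) ≠ ∞ := by
    intro h
    rw [h, ENNReal.mul_top (by norm_num)] at h2
    exact h2.ne rfl
  exact ne_top_of_le_ne_top (ENNReal.mul_ne_top ENNReal.ofReal_ne_top h3) (hd 0 le_rfl one_pos)

/-- Functions with a weighted integrability property have polynomial growth. -/
theorem ClassDHat.exists_growth {ω : ℂ → ℝ} (hω : ClassDHat ω) {q : ℝ} (hq : 0 < q) {M : ℝ}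
    (hM : 0 < M) :
    ∃ A N : ℝ, 0 < A ∧ 0 < N ∧ ∀ f : ℂ → ℂ, AnalyticOnNhd ℂ f disc →
      ∫⁻ z, ENNReal.ofReal (‖f z‖ ^ q) ∂weightMeasure ω ≤ ENNReal.ofReal M →
      ∀ z ∈ disc, ‖f z‖ ≤ A * (1 / (1 - ‖z‖)) ^ N := by
  obtain ⟨c, γ, hc, hγ, htail⟩ := exists_rpow_le_tail hω hω.tail_zero_ne_top
  -- In the exponent 1 + γ, the 1 comes from the pointwise estimate and γ from the lower bound for
  -- the tail.
  refine ⟨(M * 2 ^ (1 + γ) / c) ^ (1 / q), (1 + γ) / q, by positivity, by positivity,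
    fun f hf hint z hz => ?_⟩
  have hz1 : 0 < 1 - ‖z‖ := by linarith [mem_disc.1 hz]
  have hz0 := norm_nonneg z
  have h1 := (hω.1.norm_rpow_mul_tail_le hf hq hz).trans hint
  have h2 := htail ((1 + ‖z‖) / 2) (by positivity) (by linarith)
  rw [show 1 - (1 + ‖z‖) / 2 = (1 - ‖z‖) / 2 by ring] at h2
  have h3 : ENNReal.ofReal (‖f z‖ ^ q * ((1 - ‖z‖) / 2) * (c * ((1 - ‖z‖) / 2) ^ γ)) ≤
      ENNReal.ofReal M := by
    rw [ENNReal.ofReal_mul (by positivity)]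
    exact le_trans (by gcongr) h1
  rw [ENNReal.ofReal_le_ofReal_iff hM.le] at h3
  have h4 : ‖f z‖ ^ q ≤ M * 2 ^ (1 + γ) / c * (1 / (1 - ‖z‖)) ^ (1 + γ) := by
    rw [Real.div_rpow zero_le_one hz1.le, Real.one_rpow, div_mul_div_comm, mul_one,
      le_div_iff₀ (by positivity)]
    rw [show ‖f z‖ ^ q * ((1 - ‖z‖) / 2) * (c * ((1 - ‖z‖) / 2) ^ γ) =
      ‖f z‖ ^ q * c * (((1 - ‖z‖) / 2) * ((1 - ‖z‖) / 2) ^ γ) by ring,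
      ← Real.rpow_one_add' (by positivity) (by positivity),
      Real.div_rpow hz1.le zero_le_two, ← mul_div_assoc, div_le_iff₀ (by positivity)] at h3
    linarith
  calc ‖f z‖ = (‖f z‖ ^ q) ^ (1 / q) := by
        rw [← Real.rpow_mul (norm_nonneg _), mul_one_div_cancel hq.ne', Real.rpow_one]
    _ ≤ (M * 2 ^ (1 + γ) / c * (1 / (1 - ‖z‖)) ^ (1 + γ)) ^ (1 / q) := by gcongr
    _ = _ := by
        rw [Real.mul_rpow (by positivity) (by positivity), ← Real.rpow_mul (by positivity),
          mul_one_div]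

/-- A small negative power of the distance to the boundary is integrable. -/
theorem ClassD.exists_lintegral_rpow_lt_top {ω : ℂ → ℝ} (hω : ClassD ω) :
    ∃ δ : ℝ, 0 < δ ∧ ∫⁻ z, ENNReal.ofReal ((1 / (1 - ‖z‖)) ^ δ) ∂weightMeasure ω < ∞ := by
  obtain ⟨hU, hw, K, C, hK, hC, hd⟩ := hω
  obtain ⟨ε, A, hε, hA, -, hint⟩ := exists_lintegral_rpow_le hK hC hd
  refine ⟨ε, hε, ?_⟩
  have h1 := hw.lintegral_radial_le (g := fun s => ENNReal.ofReal ((1 / (1 - s)) ^ ε))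
    (by fun_prop)
  refine h1.trans_lt (ENNReal.mul_lt_top (by simp) ?_)
  have h2 := hint 0 le_rfl one_pos
  simp only [sub_zero] at h2
  exact h2.trans_lt (ENNReal.mul_lt_top ENNReal.ofReal_lt_top hU.tail_zero_ne_top.lt_top)

/-! ### The auxiliary weight -/

theorem ClassL.measurable_max {Ψ : ℝ → ℝ} (hΨ : ClassL Ψ) : Measurable fun x => Ψ (max x 0) :=
  hΨ.measurable.comp (g := fun x : Set.Ici (0 : ℝ) => Ψ x)
    (f := fun x : ℝ => ⟨max x 0, le_max_right x 0⟩)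
    (Measurable.subtype_mk (measurable_id.max measurable_const))

theorem ClassL.aemeasurable_radial {Ψ : ℝ → ℝ} (hΨ : ClassL Ψ) :
    AEMeasurable (fun z => Ψ (1 / (1 - ‖z‖))) areaMeasure := by
  refine ⟨fun z => Ψ (max (1 / (1 - ‖z‖)) 0),
    hΨ.measurable_max.comp (g := fun x => Ψ (max x 0)) (f := fun z : ℂ => 1 / (1 - ‖z‖))
      (by fun_prop), ae_areaMeasure_of_forall fun z hz => ?_⟩
  have : 0 < 1 - ‖z‖ := by linarith [mem_disc.1 hz]
  simp only
  rw [max_eq_left (by positivity)]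

theorem ClassD.isRadialWeight_auxWeight {ω : ℂ → ℝ} (hω : ClassD ω) {Ψ : ℝ → ℝ} (hΨ : ClassL Ψ) :
    IsRadialWeight (auxWeight ω Ψ) where
  nonneg z hz := by
    have : 0 < 1 - ‖z‖ := by linarith [mem_disc.1 hz]
    exact mul_nonneg (hΨ.pos _ (by positivity)).le (hω.1.1.nonneg z hz)
  integrable := by
    refine ⟨(hΨ.aemeasurable_radial.mul hω.1.1.aemeasurable).aestronglyMeasurable, ?_⟩
    obtain ⟨δ, hδ, hfin⟩ := hω.exists_lintegral_rpow_lt_top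
    obtain ⟨A, hA, hP⟩ := hΨ.radial_le hδ
    rw [hω.1.1.lintegral_weightMeasure] at hfin
    refine lt_of_le_of_lt ?_ (ENNReal.mul_lt_top (ENNReal.ofReal_lt_top (r := A * Ψ 1)) hfin)
    rw [← lintegral_const_mul' _ _ ENNReal.ofReal_ne_top]
    refine lintegral_mono_ae (ae_areaMeasure_of_forall fun z hz => ?_)
    have hz1 : 0 < 1 - ‖z‖ := by linarith [mem_disc.1 hz]
    have hΨz := hΨ.pos (1 / (1 - ‖z‖)) (by positivity)
    have hΨ1 := hΨ.pos 1 zero_le_one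
    have hωz := hω.1.1.nonneg z hz
    have h1 := (hP 0 ‖z‖ le_rfl (norm_nonneg z) (mem_disc.1 hz)).1
    rw [sub_zero, div_one] at h1
    rw [auxWeight, Real.enorm_of_nonneg (by positivity), ← ENNReal.ofReal_mul (by positivity),
      ← ENNReal.ofReal_mul (by positivity)]
    refine ENNReal.ofReal_le_ofReal ?_
    calc Ψ (1 / (1 - ‖z‖)) * ω z ≤ A * (1 / (1 - ‖z‖)) ^ δ * Ψ 1 * ω z := by gcongr
      _ = _ := by ring
  radial z hz := by
    simp only [auxWeight, Complex.norm_real, norm_norm]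
    rw [hω.1.1.radial z hz]
  tail_pos r hr hr1 := by
    obtain ⟨B, hB, h⟩ := exists_tail_auxWeight_comparable hΨ hω.2 hω.1.tail_zero_ne_top
    have h1 : 0 < 1 - r := by linarith
    have h2 := (h r hr hr1).2
    by_contra h0
    rw [not_lt, nonpos_iff_eq_zero] at h0
    rw [h0, mul_zero, nonpos_iff_eq_zero, mul_eq_zero] at h2
    rcases h2 with h2 | h2
    · exact (ENNReal.ofReal_pos.2 (hΨ.pos (1 / (1 - r)) (by positivity))).ne' h2
    · exact (hω.1.1.tail_pos r hr hr1).ne' h2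

theorem ofReal_mul_ofReal_mul {a : ℝ} (ha : 0 ≤ a) (b : ℝ) (x : ℝ≥0∞) :
    ENNReal.ofReal a * (ENNReal.ofReal b * x) = ENNReal.ofReal (a * b) * x := by
  rw [← mul_assoc, ← ENNReal.ofReal_mul ha]

/-- The auxiliary weight is two-sided doubling. -/
theorem ClassD.auxWeight {ω : ℂ → ℝ} (hω : ClassD ω) {Ψ : ℝ → ℝ} (hΨ : ClassL Ψ) :
    ClassD (auxWeight ω Ψ) := by
  have hW := hω.isRadialWeight_auxWeight hΨ
  obtain ⟨B, hB, hcomp⟩ := exists_tail_auxWeight_comparable hΨ hω.2 hω.1.tail_zero_ne_top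
  set W := BergmanZygmund.auxWeight ω Ψ
  obtain ⟨⟨-, C₁, hC₁, hup⟩, -, K, C, hK, hC, hlow⟩ := hω
  constructor
  · obtain ⟨A, hA, hP⟩ := hΨ.radial_le one_pos
    refine ⟨hW, max 1 (B * C₁ * (A * 2) * B), le_max_left _ _, fun r hr hr1 => ?_⟩
    set m := (1 + r) / 2 with hm
    have hm1 : 0 < 1 - m := by linarith
    have hψr := hΨ.pos (1 / (1 - r)) (div_nonneg zero_le_one (by linarith))
    have hψm := hΨ.pos (1 / (1 - m)) (by positivity)
    have h1 := (hP r m hr (by linarith) (by linarith)).2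
    rw [show (1 - r) / (1 - m) = 2 by rw [div_eq_iff hm1.ne']; linarith, Real.rpow_one] at h1
    calc tail W r ≤ ENNReal.ofReal (B * Ψ (1 / (1 - r))) * tail ω r := (hcomp r hr hr1).1
      _ ≤ ENNReal.ofReal (B * (A * 2 * Ψ (1 / (1 - m)))) * (ENNReal.ofReal C₁ * tail ω m) := by
        gcongr
        exact hup r hr hr1
      _ = ENNReal.ofReal (B * C₁ * (A * 2)) * (ENNReal.ofReal (Ψ (1 / (1 - m))) * tail ω m) := by
        rw [ofReal_mul_ofReal_mul (by positivity), ofReal_mul_ofReal_mul (by positivity)]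
        congr 2
        ring
      _ ≤ ENNReal.ofReal (B * C₁ * (A * 2)) * (ENNReal.ofReal B * tail W m) := by
        exact mul_le_mul_right (hcomp m (by linarith) (by linarith)).2 _
      _ = ENNReal.ofReal (B * C₁ * (A * 2) * B) * tail W m := by
        rw [← mul_assoc, ← ENNReal.ofReal_mul (by positivity)]
      _ ≤ _ := by gcongr; exact le_max_right _ _
  · obtain ⟨ε, -, hε, -, hKε, -⟩ := exists_lintegral_rpow_le hK hC hlow
    obtain ⟨A, hA, hP⟩ := hΨ.radial_le hε
    have hK0 : 0 < K := by linarith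
    have hQ : 0 < K ^ ε := by positivity
    -- Iterating reverse doubling n + 1 times gains C^(n+1), while comparing tails and values of Ψ
    -- costs only BAB(K^ε)^(n+1). As K^ε < C, a large n leaves a net factor 2.
    obtain ⟨n, hn⟩ := pow_unbounded_of_one_lt (2 * (B * A * B)) ((one_lt_div hQ).2 hKε)
    have hn' : 2 * (B * A * B) * (K ^ ε) ^ (n + 1) ≤ C ^ (n + 1) := by
      rw [← le_div_iff₀ (by positivity), ← div_pow]
      exact hn.le.trans (pow_le_pow_right₀ ((one_lt_div hQ).2 hKε).le n.le_succ)
    refine ⟨hW, K ^ (n + 1), 2, one_lt_pow₀ hK n.succ_ne_zero, one_lt_two, fun r hr hr1 => ?_⟩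
    have hr1' : 0 < 1 - r := by linarith
    set m := 1 - (1 - r) / K ^ (n + 1) with hm
    have hdiv : 0 < (1 - r) / K ^ (n + 1) := by positivity
    have hdiv' : (1 - r) / K ^ (n + 1) ≤ 1 - r := div_le_self hr1'.le (one_le_pow₀ hK.le)
    have hm1 : 0 < 1 - m := by linarith
    have hψr := hΨ.pos (1 / (1 - r)) (by positivity)
    have hψm := hΨ.pos (1 / (1 - m)) (by positivity)
    have h1 := (hP r m hr (by linarith) (by linarith)).1
    rw [show (1 - r) / (1 - m) = K ^ (n + 1) by
      rw [hm, sub_sub_cancel, div_div_cancel₀ hr1'.ne']] at h1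
    have hpow : (K ^ (n + 1)) ^ ε = (K ^ ε) ^ (n + 1) := by
      rw [← Real.rpow_natCast, ← Real.rpow_natCast, ← Real.rpow_mul hK0.le,
        ← Real.rpow_mul hK0.le, mul_comm]
    rw [hpow] at h1
    set D := B * A * B * (K ^ ε) ^ (n + 1) with hD
    have hD0 : 0 < D := by positivity
    have h2 : ENNReal.ofReal D * (ENNReal.ofReal 2 * tail W m) ≤ ENNReal.ofReal D * tail W r := by
      calc ENNReal.ofReal D * (ENNReal.ofReal 2 * tail W m)
          = ENNReal.ofReal (2 * (B * A * B) * (K ^ ε) ^ (n + 1)) * tail W m := by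
            rw [← mul_assoc, ← ENNReal.ofReal_mul hD0.le]
            congr 2
            rw [hD]
            ring
        _ ≤ ENNReal.ofReal (C ^ (n + 1)) *
            (ENNReal.ofReal (B * (A * (K ^ ε) ^ (n + 1) * Ψ (1 / (1 - r)))) * tail ω m) := by
            gcongr
            refine (hcomp m (by linarith) (by linarith)).1.trans ?_
            gcongr
        _ = ENNReal.ofReal (B * (A * (K ^ ε) ^ (n + 1) * Ψ (1 / (1 - r)))) *
            (ENNReal.ofReal (C ^ (n + 1)) * tail ω m) := by ring
        _ ≤ ENNReal.ofReal (B * (A * (K ^ ε) ^ (n + 1) * Ψ (1 / (1 - r)))) * tail ω r := by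
            gcongr
            exact pow_mul_tail_le hK hC hlow (n + 1) r hr hr1
        _ = ENNReal.ofReal (B * A * (K ^ ε) ^ (n + 1)) *
            (ENNReal.ofReal (Ψ (1 / (1 - r))) * tail ω r) := by
            rw [ofReal_mul_ofReal_mul (by positivity)]
            congr 2
            ring
        _ ≤ ENNReal.ofReal (B * A * (K ^ ε) ^ (n + 1)) * (ENNReal.ofReal B * tail W r) := by
            exact mul_le_mul_right (hcomp r hr hr1).2 _
        _ = ENNReal.ofReal D * tail W r := by
            rw [← mul_assoc, ← ENNReal.ofReal_mul (by positivity)]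
            congr 2
            rw [hD]
            ring
    exact (ENNReal.mul_le_mul_iff_right (ENNReal.ofReal_pos.2 hD0).ne' ENNReal.ofReal_ne_top).1 h2

/-! ### Control of one functional by another -/

/-- `N'` is controlled by `N` on analytic functions: sets bounded for `N` are bounded for `N'`, and
functions small for `N` are small for `N'`. -/
def Controls (N N' : (ℂ → ℂ) → ℝ≥0∞) : Prop :=
  (∀ M : ℝ, ∃ M' : ℝ, ∀ f, AnalyticOnNhd ℂ f disc →
    N f ≤ ENNReal.ofReal M → N' f ≤ ENNReal.ofReal M') ∧
  ∀ ε : ℝ, 0 < ε → ∃ δ : ℝ, 0 < δ ∧ ∀ f, AnalyticOnNhd ℂ f disc →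
    N f ≤ ENNReal.ofReal δ → N' f ≤ ENNReal.ofReal ε

theorem Controls.rpow {N N' : (ℂ → ℂ) → ℝ≥0∞} (h : Controls N N') {p : ℝ} (hp : 0 < p) :
    Controls (fun f => N f ^ (1 / p)) (fun f => N' f ^ (1 / p)) := by
  have hp' : 0 < 1 / p := by positivity
  have up {x : ℝ≥0∞} {a : ℝ} (ha : 0 ≤ a) (hx : x ^ (1 / p) ≤ ENNReal.ofReal a) :
      x ≤ ENNReal.ofReal (a ^ p) := by
    rw [← ENNReal.ofReal_rpow_of_nonneg ha hp.le]
    rwa [one_div, ENNReal.rpow_inv_le_iff hp] at hx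
  have down {x : ℝ≥0∞} {a : ℝ} (ha : 0 ≤ a) (hx : x ≤ ENNReal.ofReal (a ^ p)) :
      x ^ (1 / p) ≤ ENNReal.ofReal a := by
    rw [← ENNReal.ofReal_rpow_of_nonneg ha hp.le] at hx
    rwa [one_div, ENNReal.rpow_inv_le_iff hp]
  constructor
  · intro M
    obtain ⟨M', hM'⟩ := h.1 ((max M 0) ^ p)
    refine ⟨(max M' 0) ^ (1 / p), fun f hf hM => down (by positivity) ?_⟩
    rw [← Real.rpow_mul (le_max_right _ _), one_div_mul_cancel hp.ne', Real.rpow_one]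
    refine (hM' f hf (up (le_max_right _ _) (hM.trans ?_))).trans ?_
    · exact ENNReal.ofReal_le_ofReal (le_max_left _ _)
    · exact ENNReal.ofReal_le_ofReal (le_max_left _ _)
  · intro ε hε
    obtain ⟨δ, hδ, h'⟩ := h.2 (ε ^ p) (by positivity)
    refine ⟨δ ^ (1 / p), by positivity, fun f hf hN => down hε.le (h' f hf ?_)⟩
    have := up (by positivity) hN
    rwa [← Real.rpow_mul hδ.le, one_div_mul_cancel hp.ne', Real.rpow_one] at this

theorem controls_of_le_mul {N N' : (ℂ → ℂ) → ℝ≥0∞}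
    (h : ∀ M : ℝ, 0 < M → ∃ C : ℝ, 0 < C ∧ ∀ f, AnalyticOnNhd ℂ f disc →
      N f ≤ ENNReal.ofReal M → N' f ≤ ENNReal.ofReal C * N f) : Controls N N' := by
  constructor
  · intro M
    obtain ⟨C, hC, h'⟩ := h (max M 1) (by positivity)
    refine ⟨C * max M 1, fun f hf hM => ?_⟩
    have hM1 : N f ≤ ENNReal.ofReal (max M 1) :=
      hM.trans (ENNReal.ofReal_le_ofReal (le_max_left _ _))
    rw [ENNReal.ofReal_mul hC.le]
    exact (h' f hf hM1).trans (by gcongr)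
  · intro ε hε
    obtain ⟨C, hC, h'⟩ := h 1 one_pos
    refine ⟨min 1 (ε / C), by positivity, fun f hf hN => ?_⟩
    refine (h' f hf (hN.trans (ENNReal.ofReal_le_ofReal (min_le_left _ _)))).trans ?_
    calc ENNReal.ofReal C * N f ≤ ENNReal.ofReal C * ENNReal.ofReal (ε / C) := by
          gcongr
          exact hN.trans (ENNReal.ofReal_le_ofReal (min_le_right _ _))
      _ = ENNReal.ofReal ε := by rw [← ENNReal.ofReal_mul hC.le, mul_div_cancel₀ _ hC.ne']

/-- The error term is independent of f: η is fixed first to make it small, which determines C, and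
only then is δ chosen. -/
theorem controls_of_le_mul_add {N N' : (ℂ → ℂ) → ℝ≥0∞} {J : ℝ≥0∞} (hJ : J ≠ ∞)
    (h : ∀ η : ℝ, 0 < η → ∃ C : ℝ, 0 < C ∧ ∀ f, AnalyticOnNhd ℂ f disc →
      N' f ≤ ENNReal.ofReal C * N f + ENNReal.ofReal η * J) : Controls N N' := by
  have hJ' : J = ENNReal.ofReal J.toReal := (ENNReal.ofReal_toReal hJ).symm
  have hJ0 : 0 ≤ J.toReal := ENNReal.toReal_nonneg
  constructor
  · intro M
    obtain ⟨C, hC, h'⟩ := h 1 one_pos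
    refine ⟨C * max M 0 + J.toReal, fun f hf hM => (h' f hf).trans ?_⟩
    rw [ENNReal.ofReal_add (by positivity) hJ0, ← hJ', ENNReal.ofReal_one, one_mul,
      ENNReal.ofReal_mul hC.le]
    gcongr
    exact hM.trans (ENNReal.ofReal_le_ofReal (le_max_left _ _))
  · intro ε hε
    obtain ⟨C, hC, h'⟩ := h (ε / 2 / (J.toReal + 1)) (by positivity)
    refine ⟨ε / 2 / C, by positivity, fun f hf hN => (h' f hf).trans ?_⟩
    calc ENNReal.ofReal C * N f + ENNReal.ofReal (ε / 2 / (J.toReal + 1)) * J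
        ≤ ENNReal.ofReal C * ENNReal.ofReal (ε / 2 / C) +
          ENNReal.ofReal (ε / 2 / (J.toReal + 1)) * ENNReal.ofReal (J.toReal + 1) := by
          gcongr
          conv_lhs => rw [hJ']
          exact ENNReal.ofReal_le_ofReal (by linarith)
      _ = ENNReal.ofReal ε := by
          rw [← ENNReal.ofReal_mul hC.le, ← ENNReal.ofReal_mul (by positivity),
            mul_div_cancel₀ _ hC.ne', div_mul_cancel₀ _ (by positivity),
            ← ENNReal.ofReal_add (by positivity) (by positivity), add_halves]

theorem Controls.lt_top {N N' : (ℂ → ℂ) → ℝ≥0∞} (h : Controls N N') {f : ℂ → ℂ}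
    (hf : AnalyticOnNhd ℂ f disc) (hN : N f < ∞) : N' f < ∞ := by
  obtain ⟨M', hM'⟩ := h.1 (N f).toReal
  exact (hM' f hf (ENNReal.ofReal_toReal hN.ne).ge).trans_lt ENNReal.ofReal_lt_top

theorem Controls.isBddSet {N N' : (ℂ → ℂ) → ℝ≥0∞} (h : Controls N N') {S : Set (ℂ → ℂ)}
    (hS : ∀ f ∈ S, AnalyticOnNhd ℂ f disc) (hb : IsBddSet N S) : IsBddSet N' S := by
  obtain ⟨M, hM⟩ := hb
  obtain ⟨M', hM'⟩ := h.1 M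
  exact ⟨M', fun f hf => hM' f (hS f hf) (hM f hf)⟩

theorem Controls.tendsto {N N' : (ℂ → ℂ) → ℝ≥0∞} (h : Controls N N') {f : ℕ → ℂ → ℂ}
    (hf : ∀ n, AnalyticOnNhd ℂ (f n) disc) (ht : Tendsto (fun n => N (f n)) atTop (𝓝 0)) :
    Tendsto (fun n => N' (f n)) atTop (𝓝 0) := by
  rw [ENNReal.tendsto_nhds_zero] at ht ⊢
  intro ε hε
  obtain ⟨ε', hε', hle⟩ : ∃ ε' : ℝ, 0 < ε' ∧ ENNReal.ofReal ε' ≤ ε := by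
    by_cases htop : ε = ∞
    · exact ⟨1, one_pos, htop ▸ le_top⟩
    · exact ⟨ε.toReal, ENNReal.toReal_pos hε.ne' htop, (ENNReal.ofReal_toReal htop).le⟩
  obtain ⟨δ, hδ, h'⟩ := h.2 ε' hε'
  filter_upwards [ht (ENNReal.ofReal δ) (ENNReal.ofReal_pos.2 hδ)] with n hn
  exact (h' (f n) (hf n) hn).trans hle

/-! ### Comparison of the two integrals -/

/-- Two integrands that are comparable up to polynomial growth, and up to small powers of the
distance to the boundary, define equivalent modes of boundedness for analytic functions. -/
theorem ClassD.controls {ω : ℂ → ℝ} (hω : ClassD ω) {q : ℝ} (hq : 0 < q) {G H : ℝ → ℝ → ℝ}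
    (hG : ∀ x R : ℝ, 0 ≤ x → 1 ≤ R → 0 ≤ G x R)
    (h₁ : ∃ C : ℝ, 0 < C ∧ ∀ x R : ℝ, 0 ≤ x → 1 ≤ R → x ^ q ≤ C * (1 + G x R))
    (h₂ : ∀ A N : ℝ, 0 < A → 0 < N → ∃ C : ℝ, 0 < C ∧ ∀ x R : ℝ, 0 ≤ x → 1 ≤ R →
      x ≤ A * R ^ N → H x R ≤ C * G x R)
    (h₃ : ∀ δ η : ℝ, 0 < δ → 0 < η → ∃ C : ℝ, 0 < C ∧ ∀ x R : ℝ, 0 ≤ x → 1 ≤ R →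
      G x R ≤ C * H x R + η * R ^ δ) :
    let a := fun (F : ℝ → ℝ → ℝ) (f : ℂ → ℂ) =>
      ∫⁻ z, ENNReal.ofReal (F ‖f z‖ (1 / (1 - ‖z‖))) ∂weightMeasure ω
    Controls (a G) (a H) ∧ Controls (a H) (a G) := by
  intro a
  have hae {P : ℂ → Prop} (h : ∀ z ∈ disc, P z) : ∀ᵐ z ∂weightMeasure ω, P z :=
    (withDensity_absolutelyContinuous _ _).ae_le (ae_areaMeasure_of_forall h)
  have hR {z : ℂ} (hz : z ∈ disc) : 1 ≤ 1 / (1 - ‖z‖) := by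
    have := mem_disc.1 hz
    rw [one_le_div (by linarith)]
    linarith [norm_nonneg z]
  constructor
  · refine controls_of_le_mul fun M hM => ?_
    obtain ⟨C₁, hC₁, h₁⟩ := h₁
    set V := (weightMeasure ω Set.univ).toReal with hV
    have hV' : weightMeasure ω Set.univ = ENNReal.ofReal V :=
      (ENNReal.ofReal_toReal hω.1.1.measure_univ_lt_top.ne).symm
    have hV0 : 0 ≤ V := ENNReal.toReal_nonneg
    -- A bound M on the G-integral bounds ∫|f|^q through `h₁`, so A and N depend on M but not on f;
    -- the growth bound then puts every point in the range of `h₂`.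
    obtain ⟨A, N, hA, hN, hgrowth⟩ := hω.1.exists_growth hq (M := C₁ * (V + M)) (by positivity)
    obtain ⟨C, hC, h₂⟩ := h₂ A N hA hN
    refine ⟨C, hC, fun f hf hM' => ?_⟩
    have hint : ∫⁻ z, ENNReal.ofReal (‖f z‖ ^ q) ∂weightMeasure ω ≤
        ENNReal.ofReal (C₁ * (V + M)) := by
      calc ∫⁻ z, ENNReal.ofReal (‖f z‖ ^ q) ∂weightMeasure ω
          ≤ ∫⁻ z, ENNReal.ofReal C₁ *
              (1 + ENNReal.ofReal (G ‖f z‖ (1 / (1 - ‖z‖)))) ∂weightMeasure ω := by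
            refine lintegral_mono_ae (hae fun z hz => ?_)
            have hG0 := hG ‖f z‖ _ (norm_nonneg _) (hR hz)
            rw [← ENNReal.ofReal_one, ← ENNReal.ofReal_add zero_le_one hG0,
              ← ENNReal.ofReal_mul hC₁.le]
            exact ENNReal.ofReal_le_ofReal (h₁ _ _ (norm_nonneg _) (hR hz))
        _ = ENNReal.ofReal C₁ * (ENNReal.ofReal V + a G f) := by
            rw [lintegral_const_mul' _ _ ENNReal.ofReal_ne_top,
              lintegral_add_left measurable_const, lintegral_one, hV']
        _ ≤ ENNReal.ofReal C₁ * (ENNReal.ofReal V + ENNReal.ofReal M) := by gcongr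
        _ = _ := by rw [ENNReal.ofReal_mul hC₁.le, ENNReal.ofReal_add hV0 hM.le]
    rw [← lintegral_const_mul' _ _ ENNReal.ofReal_ne_top]
    refine lintegral_mono_ae (hae fun z hz => ?_)
    rw [← ENNReal.ofReal_mul hC.le]
    exact ENNReal.ofReal_le_ofReal (h₂ _ _ (norm_nonneg _) (hR hz) (hgrowth f hf hint z hz))
  · obtain ⟨δ, hδ, hJ⟩ := hω.exists_lintegral_rpow_lt_top
    refine controls_of_le_mul_add hJ.ne fun η hη => ?_
    obtain ⟨C, hC, h₃⟩ := h₃ δ η hδ hη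
    refine ⟨C, hC, fun f hf => ?_⟩
    rw [← lintegral_const_mul' _ _ ENNReal.ofReal_ne_top,
      ← lintegral_const_mul' _ _ ENNReal.ofReal_ne_top, ← lintegral_add_right _ (by fun_prop)]
    refine lintegral_mono_ae (hae fun z hz => ?_)
    have hz1 : 0 < 1 - ‖z‖ := by linarith [mem_disc.1 hz]
    rw [← ENNReal.ofReal_mul hC.le, ← ENNReal.ofReal_mul hη.le]
    exact (ENNReal.ofReal_le_ofReal (h₃ _ _ (norm_nonneg _) (hR hz))).trans ENNReal.ofReal_add_le

/-- Split at x = κ R^δ₁. Below it x^p ≤ (η/A) R^(δ/2), and the bound on u supplies the other half of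
R^δ. Above it R is at most a constant times a power of x, so u is comparable to v. -/
theorem exists_rpow_mul_le_add {p A δ η : ℝ} (hp : 0 < p) (hA : 0 < A) (hδ : 0 < δ) (hη : 0 < η)
    {u v : ℝ → ℝ → ℝ} (hu : ∀ x R : ℝ, 0 ≤ x → 1 ≤ R → u x R ≤ A * R ^ (δ / 2))
    (hv : ∀ x R : ℝ, 0 ≤ x → 1 ≤ R → 0 ≤ v x R)
    (huv : ∀ B N : ℝ, 0 < B → 0 < N → ∃ C : ℝ, 0 < C ∧ ∀ x R : ℝ, 0 ≤ x → 1 ≤ R →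
      R ≤ B * x ^ N → u x R ≤ C * v x R) :
    ∃ C : ℝ, 0 < C ∧ ∀ x R : ℝ, 0 ≤ x → 1 ≤ R →
      x ^ p * u x R ≤ C * (x ^ p * v x R) + η * R ^ δ := by
  set κ := (η / A) ^ (1 / p) with hκ
  have hκ0 : 0 < κ := by positivity
  have hκp : κ ^ p = η / A := by
    rw [hκ, ← Real.rpow_mul (by positivity), one_div_mul_cancel hp.ne', Real.rpow_one]
  set δ₁ := δ / (2 * p) with hδ₁
  have hδ₁0 : 0 < δ₁ := by positivity
  obtain ⟨C, hC, h⟩ := huv ((1 / κ) ^ (1 / δ₁)) (1 / δ₁) (by positivity) (by positivity)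
  refine ⟨C, hC, fun x R hx hR => ?_⟩
  have hR0 : 0 < R := by linarith
  have hv0 := hv x R hx hR
  rcases le_total x (κ * R ^ δ₁) with hxR | hxR
  · have h1 : x ^ p ≤ η / A * R ^ (δ / 2) := by
      calc x ^ p ≤ (κ * R ^ δ₁) ^ p := by gcongr
        _ = η / A * R ^ (δ / 2) := by
          rw [Real.mul_rpow hκ0.le (by positivity), hκp, ← Real.rpow_mul hR0.le, hδ₁]
          congr 2
          field_simp
    have h2 : x ^ p * u x R ≤ η * R ^ δ := by
      calc x ^ p * u x R ≤ x ^ p * (A * R ^ (δ / 2)) := by gcongr; exact hu x R hx hR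
        _ ≤ η / A * R ^ (δ / 2) * (A * R ^ (δ / 2)) := by gcongr
        _ = η / A * A * (R ^ (δ / 2) * R ^ (δ / 2)) := by ring
        _ = η * R ^ δ := by rw [div_mul_cancel₀ _ hA.ne', ← Real.rpow_add hR0, add_halves]
    have : 0 ≤ C * (x ^ p * v x R) := by positivity
    linarith
  · have h1 : R ≤ (1 / κ) ^ (1 / δ₁) * x ^ (1 / δ₁) := by
      rw [← Real.mul_rpow (by positivity) hx]
      calc R = (R ^ δ₁) ^ (1 / δ₁) := by
            rw [← Real.rpow_mul hR0.le, mul_one_div_cancel hδ₁0.ne', Real.rpow_one]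
        _ ≤ (1 / κ * x) ^ (1 / δ₁) := by
            gcongr
            rw [one_div_mul_eq_div, le_div_iff₀ hκ0]
            linarith
    have h2 := h x R hx hR h1
    calc x ^ p * u x R ≤ x ^ p * (C * v x R) := by gcongr
      _ = C * (x ^ p * v x R) := by ring
      _ ≤ _ := le_add_of_nonneg_right (by positivity)

/-- Here Ψ(R) ≳ Ψ(0), so the integral with Ψ(R) dominates ∫|f|^p and is the one that yields growth.
-/
theorem ClassD.controls_of_essIncreasing {ω : ℂ → ℝ} (hω : ClassD ω) {Ψ : ℝ → ℝ} (hΨ : ClassL Ψ)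
    (hi : EssIncreasing Ψ) {p : ℝ} (hp : 0 < p) :
    let a := fun (F : ℝ → ℝ → ℝ) (f : ℂ → ℂ) =>
      ∫⁻ z, ENNReal.ofReal (F ‖f z‖ (1 / (1 - ‖z‖))) ∂weightMeasure ω
    Controls (a fun x R => x ^ p * Ψ R) (a fun x _ => x ^ p * Ψ x) ∧
      Controls (a fun x _ => x ^ p * Ψ x) (a fun x R => x ^ p * Ψ R) := by
  refine hω.controls hp (G := fun x R => x ^ p * Ψ R) (H := fun x _ => x ^ p * Ψ x)
    (fun x R hx hR => ?_) ?_ (fun A N hA hN => ?_) fun δ η hδ hη => ?_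
  · have := hΨ.pos R (by linarith)
    positivity
  · obtain ⟨C, hC, h⟩ := hi
    have h0 := hΨ.pos 0 le_rfl
    refine ⟨C / Ψ 0, by positivity, fun x R hx hR => ?_⟩
    have h1 : 1 ≤ C / Ψ 0 * Ψ R := by
      rw [div_mul_eq_mul_div, le_div_iff₀ h0, one_mul]
      exact h 0 R le_rfl (by linarith)
    have hxp : 0 ≤ x ^ p := by positivity
    calc x ^ p ≤ x ^ p * (C / Ψ 0 * Ψ R) := le_mul_of_one_le_right hxp h1
      _ = C / Ψ 0 * (x ^ p * Ψ R) := by ring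
      _ ≤ _ := by gcongr; linarith
  · obtain ⟨C, hC, h⟩ := hi.le_of_le_rpow hΨ hA hN
    refine ⟨C, hC, fun x R hx hR hxR => ?_⟩
    calc x ^ p * Ψ x ≤ x ^ p * (C * Ψ R) := by
          gcongr
          exact h R x (by linarith) hx hxR
      _ = _ := by ring
  · obtain ⟨A, hA, hle⟩ := hi.le_rpow hΨ (half_pos hδ)
    refine exists_rpow_mul_le_add (u := fun _ R => Ψ R) (v := fun x _ => Ψ x) hp hA hδ hη
      (fun x R _ hR => hle R hR) (fun x _ hx _ => (hΨ.pos x hx).le) fun B N hB hN => ?_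
    obtain ⟨C, hC, h⟩ := hi.le_of_le_rpow hΨ hB hN
    exact ⟨C, hC, fun x R hx hR hxR => h x R hx (by linarith) hxR⟩

/-- Growth must now come from the integral with Ψ(|f|), where Ψ may decay. It decays more slowly
than any power, so x^(p/2) ≲ x^p Ψ(x) for x ≥ 1, whence the exponent q = p/2. -/
theorem ClassD.controls_of_essDecreasing {ω : ℂ → ℝ} (hω : ClassD ω) {Ψ : ℝ → ℝ} (hΨ : ClassL Ψ)
    (hd : EssDecreasing Ψ) {p : ℝ} (hp : 0 < p) :
    let a := fun (F : ℝ → ℝ → ℝ) (f : ℂ → ℂ) =>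
      ∫⁻ z, ENNReal.ofReal (F ‖f z‖ (1 / (1 - ‖z‖))) ∂weightMeasure ω
    Controls (a fun x _ => x ^ p * Ψ x) (a fun x R => x ^ p * Ψ R) ∧
      Controls (a fun x R => x ^ p * Ψ R) (a fun x _ => x ^ p * Ψ x) := by
  refine hω.controls (half_pos hp) (G := fun x _ => x ^ p * Ψ x) (H := fun x R => x ^ p * Ψ R)
    (fun x R hx hR => ?_) ?_ (fun A N hA hN => ?_) fun δ η hδ hη => ?_
  · have := hΨ.pos x hx
    positivity
  · obtain ⟨A, hA, h⟩ := (hd.inv hΨ).le_rpow hΨ.inv (half_pos hp)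
    refine ⟨max 1 A, by positivity, fun x R hx hR => ?_⟩
    have hΨx := hΨ.pos x hx
    rcases le_total x 1 with hx1 | hx1
    · calc x ^ (p / 2) ≤ 1 := Real.rpow_le_one hx hx1 (half_pos hp).le
        _ ≤ max 1 A * 1 := by rw [mul_one]; exact le_max_left _ _
        _ ≤ _ := by
          gcongr
          exact le_add_of_nonneg_right (by positivity)
    · have h1 := h x hx1
      rw [inv_le_iff_one_le_mul₀ hΨx] at h1
      calc x ^ (p / 2) ≤ x ^ (p / 2) * (A * x ^ (p / 2) * Ψ x) :=
            le_mul_of_one_le_right (by positivity) h1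
        _ = A * (x ^ (p / 2) * x ^ (p / 2) * Ψ x) := by ring
        _ = A * (x ^ p * Ψ x) := by rw [← Real.rpow_add (by linarith), add_halves]
        _ ≤ _ := by
          gcongr
          · exact le_max_right _ _
          · linarith
  · obtain ⟨C, hC, h⟩ := hd.le_of_le_rpow hΨ hA hN
    refine ⟨C, hC, fun x R hx hR hxR => ?_⟩
    calc x ^ p * Ψ R ≤ x ^ p * (C * Ψ x) := by
          gcongr
          exact h R x (by linarith) hx hxR
      _ = _ := by ring
  · obtain ⟨C₀, hC₀, hle⟩ := id hd
    have h0 := hΨ.pos 0 le_rfl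
    refine exists_rpow_mul_le_add (u := fun x _ => Ψ x) (v := fun _ R => Ψ R) (A := C₀ * Ψ 0) hp
      (by positivity) hδ hη (fun x R hx hR => ?_) (fun x R _ hR => (hΨ.pos R (by linarith)).le)
      fun B N hB hN => ?_
    · exact (hle 0 x le_rfl hx).trans
        (le_mul_of_one_le_right (by positivity) (Real.one_le_rpow hR (half_pos hδ).le))
    · obtain ⟨C, hC, h⟩ := hd.le_of_le_rpow hΨ hB hN
      exact ⟨C, hC, fun x R hx hR hxR => h x R hx (by linarith) hxR⟩

theorem ClassD.bergmanNorm_auxWeight {ω : ℂ → ℝ} (hω : ClassD ω) {Ψ : ℝ → ℝ} (hΨ : ClassL Ψ)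
    (p : ℝ) (f : ℂ → ℂ) :
    bergmanNorm p (BergmanZygmund.auxWeight ω Ψ) f =
      (∫⁻ z, ENNReal.ofReal (‖f z‖ ^ p * Ψ (1 / (1 - ‖z‖))) ∂weightMeasure ω) ^ (1 / p) := by
  rw [bergmanNorm, bergmanZygmundNorm, zygmundNorm]
  congr 1
  rw [(hω.isRadialWeight_auxWeight hΨ).lintegral_weightMeasure, hω.1.1.lintegral_weightMeasure]
  refine lintegral_congr_ae (ae_areaMeasure_of_forall fun z hz => ?_)
  have hz1 : 0 < 1 - ‖z‖ := by linarith [mem_disc.1 hz]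
  have hΨz := hΨ.pos (1 / (1 - ‖z‖)) (by positivity)
  have hωz := hω.1.1.nonneg z hz
  simp only [BergmanZygmund.auxWeight]
  rw [← ENNReal.ofReal_mul (by positivity), ← ENNReal.ofReal_mul hωz]
  congr 1
  ring

/-- The two norms control each other. -/
theorem ClassD.controls_bergmanNorm {ω : ℂ → ℝ} (hω : ClassD ω) {Ψ : ℝ → ℝ} (hΨ : ClassL Ψ)
    {p : ℝ} (hp : 0 < p) :
    Controls (bergmanZygmundNorm p ω Ψ) (bergmanNorm p (BergmanZygmund.auxWeight ω Ψ)) ∧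
      Controls (bergmanNorm p (BergmanZygmund.auxWeight ω Ψ)) (bergmanZygmundNorm p ω Ψ) := by
  rw [funext (hω.bergmanNorm_auxWeight hΨ p)]
  rcases hΨ.essMonotonic with hi | hd
  · obtain ⟨h1, h2⟩ := hω.controls_of_essIncreasing hΨ hi hp
    exact ⟨h2.rpow hp, h1.rpow hp⟩
  · obtain ⟨h1, h2⟩ := hω.controls_of_essDecreasing hΨ hd hp
    exact ⟨h1.rpow hp, h2.rpow hp⟩

/-! ### Spaces, bounded identities and convergence -/

theorem mem_bergmanZygmund_iff {p : ℝ} {ω : ℂ → ℝ} {Ψ : ℝ → ℝ} {f : ℂ → ℂ} :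
    f ∈ bergmanZygmund p ω Ψ ↔ AnalyticOnNhd ℂ f disc ∧ bergmanZygmundNorm p ω Ψ f < ∞ := by
  refine ⟨fun h => ⟨h.2, h.1.2⟩, fun h => ⟨⟨?_, h.2⟩, h.1⟩⟩
  exact (AnalyticOnNhd.aemeasurable_disc h.1).aestronglyMeasurable.mono_ac
    (withDensity_absolutelyContinuous _ _)

theorem isBddOperator_id {p : ℝ} {ω ω' : ℂ → ℝ} {Ψ Ψ' : ℝ → ℝ}
    (h : Controls (bergmanZygmundNorm p ω Ψ) (bergmanZygmundNorm p ω' Ψ')) :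
    IsBddOperator (bergmanZygmund p ω Ψ) (bergmanZygmundNorm p ω Ψ)
      (bergmanZygmund p ω' Ψ') (bergmanZygmundNorm p ω' Ψ') id := by
  refine ⟨fun f hf => ?_, fun S hS hb => ?_⟩
  · rw [mem_bergmanZygmund_iff] at hf
    exact mem_bergmanZygmund_iff.2 ⟨hf.1, h.lt_top hf.1 hf.2⟩
  · rw [Set.image_id]
    exact h.isBddSet (fun f hf => (hS hf).2) hb

end BergmanZygmund

open BergmanZygmund
theorem mainTheorem3 (p : ℝ) (hp : 0 < p) (Ψ : ℝ → ℝ) (hΨ : ClassL Ψ)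
    (ω : ℂ → ℝ) (hω : ClassD ω) :
    ClassD (auxWeight ω Ψ) ∧
    bergmanZygmund p ω Ψ = bergman p (auxWeight ω Ψ) ∧
    IsBddOperator (bergmanZygmund p ω Ψ) (bergmanZygmundNorm p ω Ψ)
      (bergman p (auxWeight ω Ψ)) (bergmanNorm p (auxWeight ω Ψ)) id ∧
    IsBddOperator (bergman p (auxWeight ω Ψ)) (bergmanNorm p (auxWeight ω Ψ))
      (bergmanZygmund p ω Ψ) (bergmanZygmundNorm p ω Ψ) id ∧
    ∀ f : ℕ → ℂ → ℂ, (∀ n, f n ∈ bergmanZygmund p ω Ψ) →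
      (Tendsto (fun n => bergmanNorm p (auxWeight ω Ψ) (f n)) atTop (𝓝 0) ↔
        Tendsto (fun n => bergmanZygmundNorm p ω Ψ (f n)) atTop (𝓝 0)) := by
  obtain ⟨h1, h2⟩ := hω.controls_bergmanNorm hΨ hp
  have b1 := isBddOperator_id (Ψ' := fun _ => 1) h1
  have b2 := isBddOperator_id (Ψ := fun _ => 1) h2
  exact ⟨hω.auxWeight hΨ, Set.Subset.antisymm b1.1 b2.1, b1, b2, fun f hf =>
    ⟨h2.tendsto fun n => (hf n).2, h1.tendsto fun n => (hf n).2⟩⟩
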